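/- Let $\beta$ be an indeterminate, $\overline{x}=-x/(1+\beta x)$, and let $\Lambda$ be the $\mathbb{Q}(\beta)$-algebra of symmetric functions in $x_1,x_2,\dots$. Let $\widehat\Lambda_\sharp$ be the algebra of symmetric formal power series in $x_1,x_2,\dots$ over $\mathbb{Q}(\beta)$ (of possibly unbounded degree), and let $\widehat\Lambda=\varprojlim_n \Lambda/U_n\subset\widehat\Lambda_\sharp$, where $U_n=\{f\in\Lambda : f(x_1,\dots,x_n,0,0,\dots)=0\}$. Let $G\Gamma$ be the algebra of all $f\in\widehat\Lambda$ such that $f(t,\overline{t},x_3,x_4,\dots)$ is independent of $t$. Write $Q(z)=\sum_{n\ge 0}q_n z^n=\prod_i\frac{1-\overline{x_i}z}{1-x_iz}$ and define the single-row $K$-theoretic $Q$-functions $GQ_n$ by $$\sum_{n\in\mathbb{Z}}GQ_nz^n=\frac{1}{1+\beta z^{-1}}\cdot\frac{Q(z)}{Q(-\beta)},\qquad \frac1{1+\beta z^{-1}}=1-\beta z^{-1}+\beta^2z^{-2}-\cdots ,$$ that is, $GQ_n=Q(-\beta)^{-1}\sum_{l\ge0}(-\beta)^l q_{n+l}$ for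 $n\ge 0$. Then: 1. For all $n\ge 1$ and $N\ge 0$, $GQ_n(x_1,\dots,x_N,0,0,\dots)\in\mathbb{Z}[\beta][x_1,\dots,x_N]$. 2. $GQ_n\in G\Gamma$ for all $n\ge1$. 3. Every element of $G\Gamma$ can be uniquely expressed as an infinite sum of elements of $\mathbb{Q}(\beta)[GQ_1,GQ_3,GQ_5,\dots]$, in the following sense: for every $f\in G\Gamma$ there is a unique family $(c_\mu)$ in $\mathbb{Q}(\beta)$, indexed by the partitions $\mu=(\mu_1\ge\dots\ge\mu_\ell)$ (including the empty one) all of whose parts are odd, such that $$f=\sum_{\mu}c_\mu\,GQ_{\mu_1}GQ_{\mu_2}\cdots GQ_{\mu_\ell},$$ where the sum is formal, in $\widehat\Lambda_\sharp$: each monomial in $x_1,x_2,\dots$ has a nonzero coefficient in only finitely many of the summands, and the coefficients add up to that of $f$. -/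

import Mathlib

noncomputable section

namespace KQ

/-- The coefficient field `ℚ(β)`. -/
abbrev K : Type := RatFunc ℚ

/-- The indeterminate `β`. -/
def β : K := RatFunc.X

/-- Formal power series over `ℚ(β)`, without any bound on the degree, in the countably many
variables `x₁, x₂, …`; the variable `x_{i+1}` is `MvPowerSeries.X i`. -/
abbrev Series : Type := MvPowerSeries ℕ K

/-- The inverse `-x / (1 + β x)` of `x` for the operation `x ⊕ y = x + y + β x y`
(used for series `x` without constant term). -/
def bar {σ : Type*} (x : MvPowerSeries σ K) : MvPowerSeries σ K :=
  -x * (1 + MvPowerSeries.C β * x)⁻¹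

/-! ### Symmetric functions -/

/-- `Λ̂_♯`: symmetric functions of possibly unbounded degree, i.e. the formal power series in
`x₁, x₂, …` that are invariant under all permutations of the variables. -/
def LambdaSharp : Subalgebra K Series :=
  ⨅ σ : Equiv.Perm ℕ,
    AlgHom.equalizer (MvPowerSeries.renameEquiv K σ).toAlgHom (AlgHom.id K Series)

/-- Formal power series of bounded degree. -/
def boundedDegree : Subalgebra K Series where
  carrier := {f | ∃ D : ℕ, ∀ d : ℕ →₀ ℕ, D < d.degree → MvPowerSeries.coeff d f = 0}
  mul_mem' := by
    rintro f g ⟨D, hD⟩ ⟨E, hE⟩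
    refine ⟨D + E, fun d hd => ?_⟩
    classical
    rw [MvPowerSeries.coeff_mul]
    refine Finset.sum_eq_zero fun p hp => ?_
    rw [Finset.HasAntidiagonal.mem_antidiagonal] at hp
    have hdeg : p.1.degree + p.2.degree = d.degree := by rw [← hp, map_add]
    by_cases h : D < p.1.degree
    · rw [hD _ h, zero_mul]
    · rw [hE _ (by omega), mul_zero]
  add_mem' := by
    rintro f g ⟨D, hD⟩ ⟨E, hE⟩
    refine ⟨max D E, fun d hd => ?_⟩
    rw [map_add, hD d (lt_of_le_of_lt (le_max_left _ _) hd),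
      hE d (lt_of_le_of_lt (le_max_right _ _) hd), add_zero]
  algebraMap_mem' := by
    intro r
    refine ⟨0, fun d hd => ?_⟩
    classical
    rw [MvPowerSeries.algebraMap_apply, MvPowerSeries.coeff_C, if_neg]
    rintro rfl
    simp at hd

/-- The `ℚ(β)`-algebra `Λ` of symmetric functions in `x₁, x₂, …`. -/
def Lambda : Subalgebra K Series := LambdaSharp ⊓ boundedDegree

/-- The specialization `f ↦ f(x₁, …, x_N, 0, 0, …)`. -/
def specialize (N : ℕ) : Series →ₐ[K] MvPowerSeries (Fin N) K :=
  MvPowerSeries.killCompl Fin.valEmbedding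

/-- The completion `Λ̂ = lim Λ / U_n`, where `U_n = {f ∈ Λ | f(x₁, …, x_n, 0, 0, …) = 0}`, realized
inside `Λ̂_♯`. As `Λ / U_n` is the image of `Λ` under `specialize n`, a symmetric series belongs to
`Λ̂` when, for each `n`, it agrees after `specialize n` with an element of `Λ`.
See `existsUnique_mem_LambdaHat` for the identification with the inverse limit. -/
def LambdaHat : Subalgebra K Series :=
  LambdaSharp ⊓ ⨅ n : ℕ, (Lambda.map (specialize n)).comap (specialize n)

/-! ### The cancellation property -/

/-- The series `t, t̄, x₃, x₄, …` in the variables `t, x₃, x₄, …`: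
the variable `t` is indexed by `none`, the variable `x_{i+3}` by `some i`. -/
def cancelPoint : ℕ → MvPowerSeries (Option ℕ) K
  | 0 => MvPowerSeries.X none
  | 1 => bar (MvPowerSeries.X none)
  | i + 2 => MvPowerSeries.X (some i)

theorem hasSubst_cancelPoint : MvPowerSeries.HasSubst cancelPoint where
  const_coeff s := by
    match s with
    | 0 => simp [cancelPoint]
    | 1 => simp [cancelPoint, bar]
    | i + 2 => simp [cancelPoint]
  coeff_zero d := by
    classical
    refine Set.Finite.subset (s := {0, 1} ∪ (fun j : Option ℕ => j.elim 0 (· + 2)) '' d.support)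
      (by
        refine Set.Finite.union (by simp) (Set.Finite.image _ (Finset.finite_toSet _))) ?_
    intro s hs
    match s with
    | 0 => simp
    | 1 => simp
    | i + 2 =>
      right
      refine ⟨some i, ?_, rfl⟩
      simp only [cancelPoint, Set.mem_ofPred_eq, MvPowerSeries.coeff_X] at hs
      by_cases h : d = Finsupp.single (some i) 1
      · subst h; simp
      · simp [h] at hs

/-- The `K`-`Q`-cancellation property: `f(t, t̄, x₃, x₄, …)` is independent of `t`,
i.e. is a power series in `x₃, x₄, …` only. -/
def cancellation : Subalgebra K Series :=
  (MvPowerSeries.rename (R := K) (Function.Embedding.some : ℕ ↪ Option ℕ)).range.comap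
    (MvPowerSeries.substAlgHom hasSubst_cancelPoint)

/-- The algebra `GΓ` of elements of `Λ̂` with the `K`-`Q`-cancellation property. -/
def GGamma : Subalgebra K Series := LambdaHat ⊓ cancellation

/-! ### Infinite sums -/

/-- `f` is the formal infinite sum of the family `u`: in every coefficient only finitely many
members of the family contribute, and they add up to the coefficient of `f`. -/
def HasFormalSum {ι : Type*} (u : ι → Series) (f : Series) : Prop :=
  ∀ d : ℕ →₀ ℕ, {i | MvPowerSeries.coeff d (u i) ≠ 0}.Finite ∧
    ∑ᶠ i, MvPowerSeries.coeff d (u i) = MvPowerSeries.coeff d f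

/-- The formal infinite sum of a family (meaningful when it exists). -/
def formalSum {ι : Type*} (u : ι → Series) : Series :=
  fun d => ∑ᶠ i, MvPowerSeries.coeff d (u i)

/-! ### The functions `q_n` and `GQ_n` -/

/-- The factor `(1 - x̄_i z) / (1 - x_i z)`, a power series in `z`. -/
def qFactor (i : ℕ) : PowerSeries Series :=
  (1 - PowerSeries.C (bar (MvPowerSeries.X i)) * PowerSeries.X) *
    PowerSeries.invOfUnit (1 - PowerSeries.C (MvPowerSeries.X i) * PowerSeries.X) 1

/-- The β-deformed `q`-function `q_n`: the coefficient of `z^n` in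
`Q(z) = ∏_i (1 - x̄_i z) / (1 - x_i z)`. The `i`-th factor is `1` modulo `x_i`, so the coefficient
of a monomial in the infinite product is its coefficient in the product over the finitely many
variables that occur in it; see `coeff_qFactor_prod`. -/
def q (n : ℕ) : Series :=
  fun d => MvPowerSeries.coeff d (PowerSeries.coeff n (∏ i ∈ d.support, qFactor i))

/-- `∑_{l ≥ 0} (-β)^l q_{n+l}`; for `n = 0` this is `Q(-β)`. -/
def qTail (n : ℕ) : Series := formalSum fun l : ℕ => (-β) ^ l • q (n + l)

/-- The single-row `K`-theoretic `Q`-function `GQ_n`, `n ≥ 0`: the coefficient of `z^n` in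
`∑_{n ∈ ℤ} GQ_n z^n = (1 + β z⁻¹)⁻¹ Q(z) / Q(-β)`,
where `(1 + β z⁻¹)⁻¹ = 1 - β z⁻¹ + β² z⁻² - ⋯`. -/
def GQ (n : ℕ) : Series := qTail n * (qTail 0)⁻¹

/-- Odd partitions: finite multisets of odd positive integers. -/
abbrev OddPartition : Type := {μ : Multiset ℕ // ∀ k ∈ μ, Odd k}

/-- The monomial `GQ_{μ₁} GQ_{μ₂} ⋯` in `GQ₁, GQ₃, GQ₅, …` attached to an odd partition. -/
def GQMonomial (μ : OddPartition) : Series := (μ.1.map GQ).prod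

/-- The inclusion `ℤ[β] → ℚ(β)`. -/
def intPolyToK : Polynomial ℤ →+* K := (Polynomial.aeval (R := ℤ) β).toRingHom

/-! ### Consistency of the definitions -/

theorem mem_LambdaSharp {f : Series} :
    f ∈ LambdaSharp ↔ ∀ (σ : Equiv.Perm ℕ) (d : ℕ →₀ ℕ),
      MvPowerSeries.coeff (d.embDomain σ.toEmbedding) f = MvPowerSeries.coeff d f := by
  have key : ∀ σ : Equiv.Perm ℕ, MvPowerSeries.rename (R := K) σ f = f ↔ ∀ d : ℕ →₀ ℕ,
      MvPowerSeries.coeff (d.embDomain σ.toEmbedding) f = MvPowerSeries.coeff d f := by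
    intro σ
    constructor
    · intro h d
      conv_lhs => rw [← h]
      exact MvPowerSeries.coeff_embDomain_rename σ.toEmbedding f d
    · intro h
      ext d
      obtain ⟨e, rfl⟩ : ∃ e : ℕ →₀ ℕ, e.embDomain σ.toEmbedding = d := by
        refine ⟨d.embDomain σ.symm.toEmbedding, ?_⟩
        ext i
        obtain ⟨j, rfl⟩ := σ.surjective i
        have h1 := Finsupp.embDomain_apply_self σ.toEmbedding
          (d.embDomain σ.symm.toEmbedding) j
        have h2 := Finsupp.embDomain_apply_self σ.symm.toEmbedding d (σ j)
        simp at h1 h2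
        simp [h1, h2]
      rw [h]
      exact MvPowerSeries.coeff_embDomain_rename σ.toEmbedding f e
  simp only [LambdaSharp, Algebra.mem_iInf]
  exact forall_congr' fun σ => key σ

theorem qFactor_inv (i : ℕ) :
    PowerSeries.invOfUnit (1 - PowerSeries.C (MvPowerSeries.X i : Series) * PowerSeries.X) 1 =
      PowerSeries.mk fun n => (MvPowerSeries.X i : Series) ^ n := by
  set x : Series := MvPowerSeries.X i
  set F : PowerSeries Series := 1 - PowerSeries.C x * PowerSeries.X
  have h1 : F * PowerSeries.invOfUnit F 1 = 1 := PowerSeries.mul_invOfUnit _ _ (by simp [F])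
  have h2 : (PowerSeries.mk fun n => x ^ n) * F = 1 := by
    ext1 n
    have : (PowerSeries.mk fun n => x ^ n) * F = (PowerSeries.mk fun n => x ^ n) -
        PowerSeries.C x * ((PowerSeries.mk fun n => x ^ n) * PowerSeries.X) := by
      simp only [F]; ring
    rw [this]
    cases n with
    | zero => simp
    | succ n => simp [PowerSeries.coeff_succ_mul_X, PowerSeries.coeff_one, pow_succ']
  calc PowerSeries.invOfUnit F 1 = ((PowerSeries.mk fun n => x ^ n) * F) *
        PowerSeries.invOfUnit F 1 := by rw [h2, one_mul]
    _ = _ := by rw [mul_assoc, h1, mul_one]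

theorem qFactor_eq (i : ℕ) : qFactor i = 1 + PowerSeries.C (MvPowerSeries.X i : Series) *
    (PowerSeries.C (1 + (1 + MvPowerSeries.C β * MvPowerSeries.X i : Series)⁻¹) * PowerSeries.X *
      PowerSeries.mk fun n => (MvPowerSeries.X i : Series) ^ n) := by
  have h1 := PowerSeries.mul_invOfUnit
    (1 - PowerSeries.C (MvPowerSeries.X i : Series) * PowerSeries.X) 1 (by simp)
  rw [qFactor_inv] at h1
  rw [qFactor, qFactor_inv, bar]
  simp only [neg_mul, map_neg, map_mul, map_add, map_one] at h1 ⊢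
  linear_combination h1

/-- The infinite product for `Q(z)` is well defined. -/
theorem coeff_qFactor_prod (n : ℕ) (d : ℕ →₀ ℕ) (s : Finset ℕ) (hs : d.support ⊆ s) :
    MvPowerSeries.coeff d (PowerSeries.coeff n (∏ i ∈ s, qFactor i)) =
      MvPowerSeries.coeff d (q n) := by
  classical
  change _ = MvPowerSeries.coeff d (PowerSeries.coeff n (∏ i ∈ d.support, qFactor i))
  obtain ⟨t, ht, rfl⟩ : ∃ t : Finset ℕ, Disjoint t d.support ∧ t ∪ d.support = s :=
    ⟨s \ d.support, Finset.sdiff_disjoint, Finset.sdiff_union_of_subset hs⟩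
  clear hs
  induction t using Finset.induction_on with
  | empty => simp
  | insert a t ha ih =>
    rw [Finset.disjoint_insert_left] at ht
    rw [Finset.insert_union, Finset.prod_insert (by simp [ha, Finsupp.notMem_support_iff.1 ht.1]),
      qFactor_eq, add_mul, one_mul, mul_assoc, map_add, map_add, ih ht.2, PowerSeries.coeff_C_mul,
      add_eq_left, mul_comm]
    have hd : d a = 0 := Finsupp.notMem_support_iff.1 ht.1
    rw [MvPowerSeries.X, MvPowerSeries.coeff_mul_monomial, if_neg]
    intro h
    have := h a
    simp [hd] at this

/-- `q_n` has no terms of degree less than `n`; in particular the sums `qTail` exist. -/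
theorem coeff_q_eq_zero {n : ℕ} {d : ℕ →₀ ℕ} (h : d.degree < n) :
    MvPowerSeries.coeff d (q n) = 0 := by
  classical
  have hmul : ∀ F G : PowerSeries Series,
      (∀ (n : ℕ) (d : ℕ →₀ ℕ), d.degree < n →
        MvPowerSeries.coeff d (PowerSeries.coeff n F) = 0) →
      (∀ (n : ℕ) (d : ℕ →₀ ℕ), d.degree < n →
        MvPowerSeries.coeff d (PowerSeries.coeff n G) = 0) →
      (∀ (n : ℕ) (d : ℕ →₀ ℕ), d.degree < n →
        MvPowerSeries.coeff d (PowerSeries.coeff n (F * G)) = 0) := by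
    intro F G hF hG n d hd
    rw [PowerSeries.coeff_mul, map_sum]
    refine Finset.sum_eq_zero fun p hp => ?_
    rw [MvPowerSeries.coeff_mul]
    refine Finset.sum_eq_zero fun e he => ?_
    rw [Finset.HasAntidiagonal.mem_antidiagonal] at hp he
    have hdeg : e.1.degree + e.2.degree = d.degree := by rw [← he, map_add]
    by_cases h1 : e.1.degree < p.1
    · rw [hF _ _ h1, zero_mul]
    · rw [hG _ _ (by omega), mul_zero]
  have hone : ∀ (n : ℕ) (d : ℕ →₀ ℕ), d.degree < n →
      MvPowerSeries.coeff d (PowerSeries.coeff n (1 : PowerSeries Series)) = 0 := by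
    intro n d hd
    rw [PowerSeries.coeff_one, if_neg (by omega), map_zero]
  have hfac : ∀ (i n : ℕ) (d : ℕ →₀ ℕ), d.degree < n →
      MvPowerSeries.coeff d (PowerSeries.coeff n (qFactor i)) = 0 := by
    intro i n d hd
    obtain ⟨m, rfl⟩ : ∃ m, n = m + 1 := ⟨n - 1, by omega⟩
    have : PowerSeries.coeff (m + 1) (qFactor i) =
        (1 + (1 + MvPowerSeries.C β * MvPowerSeries.X i : Series)⁻¹) *
          MvPowerSeries.X i ^ (m + 1) := by
      rw [qFactor_eq, map_add, PowerSeries.coeff_one, if_neg (by omega), zero_add,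
        PowerSeries.coeff_C_mul, mul_assoc, PowerSeries.coeff_C_mul,
        PowerSeries.coeff_succ_X_mul, PowerSeries.coeff_mk]
      ring
    rw [this, MvPowerSeries.X_pow_eq, MvPowerSeries.coeff_mul_monomial, if_neg]
    intro hle
    have h2 := Finsupp.degree_mono hle
    simp at h2
    omega
  change MvPowerSeries.coeff d (PowerSeries.coeff n (∏ i ∈ d.support, qFactor i)) = 0
  refine Finset.prod_induction qFactor (fun F => ∀ (n : ℕ) (d : ℕ →₀ ℕ), d.degree < n →
    MvPowerSeries.coeff d (PowerSeries.coeff n F) = 0) hmul hone (fun i _ => hfac i) n d h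

theorem hasFormalSum_qTail (n : ℕ) :
    HasFormalSum (fun l : ℕ => (-β) ^ l • q (n + l)) (qTail n) := by
  intro d
  refine ⟨(Set.finite_Iic d.degree).subset fun l hl => ?_, rfl⟩
  by_contra hlt
  refine hl ?_
  rw [MvPowerSeries.coeff_smul, coeff_q_eq_zero (by simp at hlt; omega), mul_zero]

/-- `Q(-β)` has constant term `1`, so that it is invertible. -/
theorem constantCoeff_qTail_zero : MvPowerSeries.constantCoeff (qTail 0) = 1 := by
  have h := (hasFormalSum_qTail 0 0).2
  rw [← MvPowerSeries.coeff_zero_eq_constantCoeff_apply, ← h, finsum_eq_single _ 0]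
  · simp only [pow_zero, one_smul, add_zero]
    change MvPowerSeries.coeff 0 (PowerSeries.coeff 0
      (∏ i ∈ (0 : ℕ →₀ ℕ).support, qFactor i)) = 1
    simp
  · intro l hl
    rw [MvPowerSeries.coeff_smul, coeff_q_eq_zero (by simp; omega), mul_zero]

theorem specialize_eq_iff {N : ℕ} {f g : Series} : specialize N f = specialize N g ↔
    ∀ d : ℕ →₀ ℕ, (∀ i, N ≤ i → d i = 0) →
      MvPowerSeries.coeff d f = MvPowerSeries.coeff d g := by
  constructor
  · intro h d hd
    obtain ⟨e, rfl⟩ : ∃ e : Fin N →₀ ℕ, e.embDomain Fin.valEmbedding = d := by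
      refine ⟨d.comapDomain Fin.valEmbedding Fin.valEmbedding.injective.injOn, ?_⟩
      refine Finsupp.embDomain_comapDomain ?_
      intro i hi
      by_contra hn
      refine (Finsupp.mem_support_iff.1 hi) (hd i ?_)
      by_contra hlt
      exact hn ⟨⟨i, by omega⟩, rfl⟩
    have := congrArg (MvPowerSeries.coeff e) h
    rwa [specialize, MvPowerSeries.coeff_killCompl, MvPowerSeries.coeff_killCompl] at this
  · intro h
    ext e
    rw [specialize, MvPowerSeries.coeff_killCompl, MvPowerSeries.coeff_killCompl]
    refine h _ fun i hi => Finsupp.embDomain_of_notMem_range _ _ _ ?_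
    rintro ⟨j, rfl⟩
    have := j.2
    simp at hi
    omega

/-- `Λ̂` is the inverse limit of the `Λ / U_n`: its elements correspond to the compatible
sequences of elements of `Λ` modulo `U_n`. -/
theorem existsUnique_mem_LambdaHat (g : ℕ → Series) (hg : ∀ n, g n ∈ Lambda)
    (hc : ∀ n, specialize n (g (n + 1)) = specialize n (g n)) :
    ∃! f, f ∈ LambdaHat ∧ ∀ n, specialize n f = specialize n (g n) := by
  have hbd : ∀ d : ℕ →₀ ℕ, ∃ N, ∀ i, N ≤ i → d i = 0 := by
    intro d
    refine ⟨d.support.sup id + 1, fun i hi => ?_⟩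
    by_contra h
    have := Finset.le_sup (f := id) (Finsupp.mem_support_iff.2 h)
    simp only [id] at this
    omega
  have hstep : ∀ (d : ℕ →₀ ℕ) (m n : ℕ), m ≤ n → (∀ i, m ≤ i → d i = 0) →
      MvPowerSeries.coeff d (g n) = MvPowerSeries.coeff d (g m) := by
    intro d m n hmn hd
    induction n, hmn using Nat.le_induction with
    | base => rfl
    | succ n hn ih =>
      rw [← ih]
      exact specialize_eq_iff.1 (hc n) d fun i hi => hd i (hn.trans hi)
  choose M hM using hbd
  set f : Series := fun d => MvPowerSeries.coeff d (g (M d)) with hf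
  have hfc : ∀ (d : ℕ →₀ ℕ) (n : ℕ), (∀ i, n ≤ i → d i = 0) →
      MvPowerSeries.coeff d f = MvPowerSeries.coeff d (g n) := by
    intro d n hd
    change MvPowerSeries.coeff d (g (M d)) = _
    rcases le_total (M d) n with h | h
    · exact (hstep d _ _ h (hM d)).symm
    · exact hstep d _ _ h hd
  have hfs : ∀ n, specialize n f = specialize n (g n) :=
    fun n => specialize_eq_iff.2 fun d hd => hfc d n hd
  refine ⟨f, ⟨⟨?_, ?_⟩, hfs⟩, ?_⟩
  · refine mem_LambdaSharp.2 fun σ d => ?_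
    set e := d.embDomain σ.toEmbedding
    rw [hfc e (max (M e) (M d)) fun i hi => hM e i ((le_max_left _ _).trans hi),
      hfc d (max (M e) (M d)) fun i hi => hM d i ((le_max_right _ _).trans hi)]
    exact mem_LambdaSharp.1 (hg _).1 σ d
  · simp only [SetLike.mem_coe, Algebra.mem_iInf]
    exact fun n => ⟨g n, hg n, (hfs n).symm⟩
  · rintro f' ⟨-, hf'⟩
    ext d
    rw [hfc d (M d) (hM d)]
    exact specialize_eq_iff.1 (hf' (M d)) d (hM d)

end KQ

end

noncomputable section

namespace KQ

/-! Polynomiality. Evaluating at `z = -β` gives `Q(-β) = ∏ (1 + βx_i)⁻²`, and the generating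
function reads `1 + (z + β) ∑ GQ_{n+1} zⁿ = Q(z) / Q(-β)`. In `N` variables the right side is `P /
D` with `P = ∏ (1 + βx_i)(1 + (z + β)x_i)` and `D = ∏ (1 - x_i z)`. These agree at `z = -β`, so `P -
D = (z + β) S`, and `∑ GQ_{n+1} zⁿ = S / D` has coefficients in every ring containing `β` and the
`x_i` (`specialize_GQ_mem_range`).

Membership in `GΓ`. `Q(z)` and `Q(-β)` are infinite products with one factor per variable, hence
symmetric; the factors at `t` and `t̄` multiply to `1`, hence the cancellation. A symmetric series
with polynomial specializations lies in `Λ̂` (`mem_LambdaHat_of_polynomial`).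

Expansion. Filter by degree. The lowest form of `GQ_n` is Schur's `q`-function, so that of a
monomial in the `GQ_n` is a product of Schur's functions. Those indexed by odd partitions of `k` are
independent: by Newton's identity they span the products of odd power sums, which are independent
and equally numerous (`linearIndependent_schurQProd`). Conversely, let `f` be symmetric with
cancellation and without terms below degree `k`. Since `t̄ = -t + ⋯`, its form `f_k` satisfies
`f_k(t, -t, x₃, …) = f_k(0, 0, x₃, …)`, which expresses a coefficient with a repeated exponent
through coefficients with more unequal exponents. So `f_k` is determined by its coefficients at
strict partitions (`mem_orderGE_succ_of_strict`). By Euler, strict and odd partitions of `k` are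
equinumerous, so the odd `GQ`-monomials of degree `k` form a basis of the graded piece
(`exists_leading_expansion`). Successive approximation gives existence, and independence in each
degree gives uniqueness. -/

theorem coeff_C_mul' {σ : Type*} (d : σ →₀ ℕ) (a : K) (f : MvPowerSeries σ K) :
    MvPowerSeries.coeff d (MvPowerSeries.C a * f) = a * MvPowerSeries.coeff d f := by
  simp

/-! ### Formal inverses and the operation `bar` -/

theorem bar_spec {σ : Type*} {x : MvPowerSeries σ K} (hx : MvPowerSeries.constantCoeff x = 0) :
    (1 + MvPowerSeries.C β * x) * (1 + MvPowerSeries.C β * x)⁻¹ = 1 :=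
  MvPowerSeries.mul_inv_cancel _ (by simp [hx])

theorem constantCoeff_bar {σ : Type*} {x : MvPowerSeries σ K}
    (hx : MvPowerSeries.constantCoeff x = 0) : MvPowerSeries.constantCoeff (bar x) = 0 := by
  simp [bar, hx]

theorem one_add_mul_bar {σ : Type*} {x : MvPowerSeries σ K}
    (hx : MvPowerSeries.constantCoeff x = 0) :
    1 + MvPowerSeries.C β * bar x = (1 + MvPowerSeries.C β * x)⁻¹ := by
  have h := bar_spec hx
  rw [bar]
  linear_combination -h

theorem bar_bar {σ : Type*} {x : MvPowerSeries σ K}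
    (hx : MvPowerSeries.constantCoeff x = 0) : bar (bar x) = x := by
  have h := bar_spec hx
  have h1 : (1 + MvPowerSeries.C β * bar x)⁻¹ = 1 + MvPowerSeries.C β * x := by
    rw [MvPowerSeries.inv_eq_iff_mul_eq_one (by simp [constantCoeff_bar hx]),
      one_add_mul_bar hx, h]
  rw [bar, h1, bar]
  linear_combination x * h

theorem algHom_inv {σ τ : Type*} (φ : MvPowerSeries σ K →ₐ[K] MvPowerSeries τ K)
    {f : MvPowerSeries σ K} (hf : MvPowerSeries.constantCoeff f ≠ 0)
    (hf' : MvPowerSeries.constantCoeff (φ f) ≠ 0) : φ f⁻¹ = (φ f)⁻¹ := by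
  rw [MvPowerSeries.eq_inv_iff_mul_eq_one hf', ← map_mul, MvPowerSeries.inv_mul_cancel _ hf,
    map_one]

theorem algHom_bar {σ τ : Type*} (φ : MvPowerSeries σ K →ₐ[K] MvPowerSeries τ K)
    {x : MvPowerSeries σ K} (hx : MvPowerSeries.constantCoeff x = 0)
    (hx' : MvPowerSeries.constantCoeff (φ x) = 0) : φ (bar x) = bar (φ x) := by
  have hC : φ (MvPowerSeries.C β) = MvPowerSeries.C β := φ.commutes β
  have h : φ (1 + MvPowerSeries.C β * x) = 1 + MvPowerSeries.C β * φ x := by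
    rw [map_add, map_one, map_mul, hC]
  rw [bar, bar, map_mul, map_neg, algHom_inv φ (by simp [hx]) (by rw [h]; simp [hx']), h]

/-! ### The generating factors in an arbitrary set of variables -/

/-- The factor `(1 - x̄_i z) / (1 - x_i z)` over an arbitrary set of variables. -/
def factor {σ : Type*} (i : σ) : PowerSeries (MvPowerSeries σ K) :=
  (1 - PowerSeries.C (bar (MvPowerSeries.X i)) * PowerSeries.X) *
    PowerSeries.invOfUnit (1 - PowerSeries.C (MvPowerSeries.X i) * PowerSeries.X) 1

theorem qFactor_eq_factor (i : ℕ) : qFactor i = factor i := rfl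

theorem factor_mul {σ : Type*} (i : σ) :
    factor i * (1 - PowerSeries.C (MvPowerSeries.X i) * PowerSeries.X) =
      1 - PowerSeries.C (bar (MvPowerSeries.X i)) * PowerSeries.X := by
  rw [factor, mul_assoc, PowerSeries.invOfUnit_mul _ _ (by simp), mul_one]

theorem one_sub_ne_zero {σ : Type*} (x : MvPowerSeries σ K) :
    (1 - PowerSeries.C x * PowerSeries.X : PowerSeries (MvPowerSeries σ K)) ≠ 0 := by
  intro h
  have := congrArg PowerSeries.constantCoeff h
  simp at this

theorem map_factor {σ τ : Type*} (φ : MvPowerSeries σ K →ₐ[K] MvPowerSeries τ K) (i : σ) (j : τ)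
    (h : φ (MvPowerSeries.X i) = MvPowerSeries.X j) :
    PowerSeries.map φ.toRingHom (factor i) = factor j := by
  have h1 := congrArg (PowerSeries.map φ.toRingHom) (factor_mul i)
  have hbar : φ (bar (MvPowerSeries.X i)) = bar (MvPowerSeries.X j) := by
    rw [algHom_bar φ (by simp) (by rw [h]; simp), h]
  simp only [map_mul, map_sub, map_one, PowerSeries.map_C, PowerSeries.map_X,
    AlgHom.toRingHom_eq_coe, RingHom.coe_coe, h, hbar] at h1
  exact mul_right_cancel₀ (one_sub_ne_zero _) (h1.trans (factor_mul j).symm)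

/-! ### Evaluation of the auxiliary variable `z` -/

/-- The coefficient of `z^n` has no terms of degree less than `n`. -/
def Filtered {σ : Type*} (F : PowerSeries (MvPowerSeries σ K)) : Prop :=
  ∀ (n : ℕ) (d : σ →₀ ℕ), d.degree < n → MvPowerSeries.coeff d (PowerSeries.coeff n F) = 0

namespace Filtered

variable {σ : Type*} {F G : PowerSeries (MvPowerSeries σ K)}

theorem mul (hF : Filtered F) (hG : Filtered G) : Filtered (F * G) := by
  classical
  intro n d hd
  rw [PowerSeries.coeff_mul, map_sum]
  refine Finset.sum_eq_zero fun p hp => ?_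
  rw [MvPowerSeries.coeff_mul]
  refine Finset.sum_eq_zero fun e he => ?_
  rw [Finset.HasAntidiagonal.mem_antidiagonal] at hp he
  have hdeg : e.1.degree + e.2.degree = d.degree := by rw [← he, map_add]
  by_cases h1 : e.1.degree < p.1
  · rw [hF _ _ h1, zero_mul]
  · rw [hG _ _ (by omega), mul_zero]

theorem C (g : MvPowerSeries σ K) : Filtered (PowerSeries.C g) := by
  intro n d hd
  rw [PowerSeries.coeff_C, if_neg (by omega), map_zero]

theorem one : Filtered (1 : PowerSeries (MvPowerSeries σ K)) := by
  simpa using C (σ := σ) 1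

theorem sub (hF : Filtered F) (hG : Filtered G) : Filtered (F - G) := by
  intro n d hd
  rw [map_sub, map_sub, hF n d hd, hG n d hd, sub_zero]

theorem C_mul_X {x : MvPowerSeries σ K} (hx : MvPowerSeries.constantCoeff x = 0) :
    Filtered (PowerSeries.C x * PowerSeries.X) := by
  intro n d hd
  rw [PowerSeries.coeff_C_mul, PowerSeries.coeff_X]
  split_ifs with h
  · obtain rfl : d = 0 := by
      rw [← Finsupp.degree_eq_zero_iff]; omega
    simpa using hx
  · simp

theorem prod {ι : Type*} (s : Finset ι) {F : ι → PowerSeries (MvPowerSeries σ K)}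
    (hF : ∀ i ∈ s, Filtered (F i)) : Filtered (∏ i ∈ s, F i) :=
  Finset.prod_induction F Filtered (fun _ _ h1 h2 => h1.mul h2) one hF

end Filtered

theorem filtered_factor (i : ℕ) : Filtered (factor i) := by
  intro n d hd
  obtain ⟨m, rfl⟩ : ∃ m, n = m + 1 := ⟨n - 1, by omega⟩
  have : PowerSeries.coeff (m + 1) (factor i) =
      (1 + (1 + MvPowerSeries.C β * MvPowerSeries.X i : Series)⁻¹) *
        MvPowerSeries.X i ^ (m + 1) := by
    rw [← qFactor_eq_factor, qFactor_eq, map_add, PowerSeries.coeff_one, if_neg (by omega),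
      zero_add, PowerSeries.coeff_C_mul, mul_assoc, PowerSeries.coeff_C_mul,
      PowerSeries.coeff_succ_X_mul, PowerSeries.coeff_mk]
    ring
  rw [this, MvPowerSeries.X_pow_eq, MvPowerSeries.coeff_mul_monomial, if_neg]
  intro hle
  have h2 := Finsupp.degree_mono hle
  simp at h2
  omega

/-- The substitution `x_i ↦ b x_i`, `z ↦ (a / b) z` followed by `z ↦ 1`, on filtered series; for
`b = 1` this is the evaluation at `z = a`, for `(a, b) = (1, 0)` the part on which the degrees in
`z` and in the variables agree. -/
def evalZ {σ : Type*} (a b : K) (F : PowerSeries (MvPowerSeries σ K)) : MvPowerSeries σ K :=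
  fun d => ∑ n ∈ Finset.range (d.degree + 1),
    a ^ n * b ^ (d.degree - n) * MvPowerSeries.coeff d (PowerSeries.coeff n F)

theorem coeff_evalZ {σ : Type*} (a b : K) (F : PowerSeries (MvPowerSeries σ K)) (d : σ →₀ ℕ) :
    MvPowerSeries.coeff d (evalZ a b F) = ∑ n ∈ Finset.range (d.degree + 1),
      a ^ n * b ^ (d.degree - n) * MvPowerSeries.coeff d (PowerSeries.coeff n F) := rfl

theorem evalZ_sub {σ : Type*} (a b : K) (F G : PowerSeries (MvPowerSeries σ K)) :
    evalZ a b (F - G) = evalZ a b F - evalZ a b G := by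
  ext d
  rw [map_sub]
  simp only [coeff_evalZ, map_sub, mul_sub, Finset.sum_sub_distrib]

/-- The filtration hypothesis makes the truncation at the degree of the monomial harmless: for a
splitting `d = e.1 + e.2`, only powers of `z` bounded by the degrees of `e.1` and `e.2` contribute,
and on these the exponents of `a` and `b` both add up. -/
theorem evalZ_mul {σ : Type*} (a b : K) {F G : PowerSeries (MvPowerSeries σ K)}
    (hF : Filtered F) (hG : Filtered G) :
    evalZ a b (F * G) = evalZ a b F * evalZ a b G := by
  classical
  ext d
  rw [MvPowerSeries.coeff_mul]
  simp only [coeff_evalZ]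
  have hL : ∀ n ∈ Finset.range (d.degree + 1),
      a ^ n * b ^ (d.degree - n) * MvPowerSeries.coeff d (PowerSeries.coeff n (F * G)) =
      ∑ e ∈ Finset.HasAntidiagonal.antidiagonal d, ∑ p ∈ Finset.HasAntidiagonal.antidiagonal n,
        a ^ n * b ^ (d.degree - n) * (MvPowerSeries.coeff e.1 (PowerSeries.coeff p.1 F) *
          MvPowerSeries.coeff e.2 (PowerSeries.coeff p.2 G)) := by
    intro n _
    rw [PowerSeries.coeff_mul, map_sum, Finset.mul_sum, Finset.sum_comm]
    refine Finset.sum_congr rfl fun p _ => ?_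
    rw [MvPowerSeries.coeff_mul, Finset.mul_sum]
  rw [Finset.sum_congr rfl hL, Finset.sum_comm]
  refine Finset.sum_congr rfl fun e he => ?_
  rw [Finset.HasAntidiagonal.mem_antidiagonal] at he
  have hdeg : e.1.degree + e.2.degree = d.degree := by rw [← he, map_add]
  rw [Finset.sum_mul_sum, ← Finset.sum_product', Finset.sum_sigma']
  symm
  refine Finset.sum_of_injOn (fun x : ℕ × ℕ => (⟨x.1 + x.2, x⟩ : (_ : ℕ) × ℕ × ℕ)) ?_ ?_ ?_ ?_
  · intro x _ y _ hxy
    simpa using (Sigma.mk.inj_iff.1 hxy).2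
  · intro x hx
    simp at hx ⊢
    omega
  · rintro ⟨n, p⟩ hp hnot
    simp only [Finset.mem_sigma, Finset.mem_range, Finset.HasAntidiagonal.mem_antidiagonal] at hp
    by_cases h1 : e.1.degree < p.1
    · rw [hF _ _ h1, zero_mul, mul_zero]
    · by_cases h2 : e.2.degree < p.2
      · rw [hG _ _ h2, mul_zero, mul_zero]
      · exfalso
        refine hnot ⟨p, ?_, ?_⟩
        · simp; omega
        · simp [hp.2]
  · intro x hx
    simp only [Finset.mem_product, Finset.mem_range] at hx
    have : d.degree - (x.1 + x.2) = (e.1.degree - x.1) + (e.2.degree - x.2) := by omega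
    simp only [this, pow_add]
    ring

theorem evalZ_one {σ : Type*} (a b : K) : evalZ a b (1 : PowerSeries (MvPowerSeries σ K)) = 1 := by
  classical
  ext d
  rw [coeff_evalZ, Finset.sum_eq_single 0]
  · rw [MvPowerSeries.coeff_one]
    split_ifs with h
    · subst h; simp
    · rw [PowerSeries.coeff_zero_one, MvPowerSeries.coeff_one, if_neg h, mul_zero]
  · intro n _ hn
    rw [PowerSeries.coeff_one, if_neg hn, map_zero, mul_zero]
  · simp

theorem evalZ_prod {σ ι : Type*} (a b : K) (s : Finset ι)
    {F : ι → PowerSeries (MvPowerSeries σ K)} (hF : ∀ i ∈ s, Filtered (F i)) :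
    evalZ a b (∏ i ∈ s, F i) = ∏ i ∈ s, evalZ a b (F i) := by
  classical
  induction s using Finset.induction_on with
  | empty => simp [evalZ_one]
  | insert i s hi ih =>
    rw [Finset.prod_insert hi, Finset.prod_insert hi, evalZ_mul a b (hF i (by simp))
      (Filtered.prod s fun j hj => hF j (by simp [hj])), ih fun j hj => hF j (by simp [hj])]

theorem evalZ_C_mul_X {σ : Type*} (a : K) {x : MvPowerSeries σ K}
    (hx : MvPowerSeries.constantCoeff x = 0) :
    evalZ a 1 (PowerSeries.C x * PowerSeries.X) = MvPowerSeries.C a * x := by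
  ext d
  rw [coeff_evalZ, Finset.sum_eq_single 1, coeff_C_mul']
  · simp
  · intro n _ hn
    rw [PowerSeries.coeff_C_mul, PowerSeries.coeff_X, if_neg hn]
    simp
  · intro h
    obtain rfl : d = 0 := by
      rw [← Finsupp.degree_eq_zero_iff]; simpa using h
    simp [hx]

/-- At `z = -β` the relation `factor_mul` reads `F (1 + βx) = 1 + βx̄`, and `1 + βx̄ = (1 + βx)⁻¹`.
-/
theorem evalZ_factor (i : ℕ) :
    evalZ (-β) 1 (factor i) = ((1 + MvPowerSeries.C β * MvPowerSeries.X i : Series)⁻¹) ^ 2 := by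
  have h := congrArg (evalZ (-β) 1) (factor_mul i)
  have hX : MvPowerSeries.constantCoeff (MvPowerSeries.X i : Series) = 0 := by simp
  rw [evalZ_mul _ _ (filtered_factor i) (Filtered.one.sub (Filtered.C_mul_X hX)), evalZ_sub,
    evalZ_sub, evalZ_one, evalZ_C_mul_X _ hX, evalZ_C_mul_X _ (constantCoeff_bar hX)] at h
  have h1 := one_add_mul_bar hX
  have h2 := bar_spec hX
  simp only [map_neg, neg_mul, sub_neg_eq_add] at h
  rw [h1] at h
  linear_combination (1 + MvPowerSeries.C β * MvPowerSeries.X i : Series)⁻¹ * h -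
    evalZ (-β) 1 (factor i) * h2

/-! ### Infinite products -/

/-- `W` is the infinite product of the `w i`, where the `i`-th factor only matters for the
monomials that involve the variable `i`. -/
def IsInfProd (w : ℕ → PowerSeries Series) (W : PowerSeries Series) : Prop :=
  ∀ (s : Finset ℕ) (n : ℕ) (d : ℕ →₀ ℕ), d.support ⊆ s →
    MvPowerSeries.coeff d (PowerSeries.coeff n W) =
      MvPowerSeries.coeff d (PowerSeries.coeff n (∏ i ∈ s, w i))

theorem isInfProd_q : IsInfProd factor (PowerSeries.mk q) := by
  intro s n d hd
  rw [PowerSeries.coeff_mk, ← coeff_qFactor_prod n d s hd]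
  rfl

theorem coeff_qTail (n : ℕ) (d : ℕ →₀ ℕ) (m : ℕ) (hm : d.degree < n + m) :
    MvPowerSeries.coeff d (qTail n) =
      ∑ l ∈ Finset.range m, (-β) ^ l * MvPowerSeries.coeff d (q (n + l)) := by
  rw [← (hasFormalSum_qTail n d).2, finsum_eq_sum_of_support_subset (s := Finset.range m)]
  · simp
  · intro l hl
    simp only [Finset.coe_range, Set.mem_Iio]
    by_contra hlt
    refine hl ?_
    change MvPowerSeries.coeff d ((-β) ^ l • q (n + l)) = 0
    rw [MvPowerSeries.coeff_smul, coeff_q_eq_zero (by omega), mul_zero]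

theorem qTail_zero_eq : qTail 0 = evalZ (-β) 1 (PowerSeries.mk q) := by
  ext d
  rw [coeff_qTail 0 d (d.degree + 1) (by omega), coeff_evalZ]
  simp

/-- `Q(-β)` is regarded as a series constant in `z`, so that the results on infinite products serve
for it and for `Q(z)` alike. Evaluation at `z = -β` commutes with the finite products that determine
each coefficient. -/
theorem isInfProd_qTail_zero :
    IsInfProd (fun i => PowerSeries.C
      (((1 + MvPowerSeries.C β * MvPowerSeries.X i : Series)⁻¹) ^ 2))
      (PowerSeries.C (qTail 0)) := by
  intro s n d hd
  rw [← map_prod, PowerSeries.coeff_C, PowerSeries.coeff_C]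
  split_ifs
  · rw [Finset.prod_congr rfl fun i _ => (evalZ_factor i).symm,
      ← evalZ_prod _ _ _ fun i _ => filtered_factor i, qTail_zero_eq, coeff_evalZ, coeff_evalZ]
    exact Finset.sum_congr rfl fun n _ => by rw [isInfProd_q s n d hd]
  · simp

/-- Split off the term `l = 0`. This reaches every `qTail n` from `qTail 0` and the `q n` by algebra
alone, so that membership in a subalgebra requires no closure under infinite sums. -/
theorem qTail_succ (n : ℕ) : qTail (n + 1) = β⁻¹ • (q n - qTail n) := by
  have hβ : β ≠ 0 := RatFunc.X_ne_zero
  ext d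
  rw [MvPowerSeries.coeff_smul, map_sub, coeff_qTail n d (d.degree + 2) (by omega),
    coeff_qTail (n + 1) d (d.degree + 1) (by omega),
    Finset.sum_range_succ' _ (d.degree + 1)]
  simp only [add_zero, pow_zero, one_mul, sub_add_cancel_right]
  rw [← Finset.sum_neg_distrib, Finset.mul_sum]
  refine Finset.sum_congr rfl fun l _ => ?_
  rw [show n + (l + 1) = n + 1 + l by ring, pow_succ]
  field_simp

theorem qTail_mem (A : Subalgebra K Series) (hq : ∀ n, q n ∈ A) (h0 : qTail 0 ∈ A) (n : ℕ) :
    qTail n ∈ A := by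
  induction n with
  | zero => exact h0
  | succ n ih =>
    rw [qTail_succ]
    exact A.smul_mem (A.sub_mem (hq n) ih) _

/-! ### Symmetry -/

/-- The coefficient at a permuted monomial is read off from the product over the permuted support,
and this finite product is the image of the original one under the renaming. -/
theorem IsInfProd.mem_LambdaSharp {w : ℕ → PowerSeries Series} {W : PowerSeries Series}
    (h : IsInfProd w W) (hw : ∀ (σ : Equiv.Perm ℕ) (i : ℕ),
      PowerSeries.map (MvPowerSeries.rename (R := K) σ).toRingHom (w i) = w (σ i)) (n : ℕ) :
    PowerSeries.coeff n W ∈ LambdaSharp := by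
  rw [KQ.mem_LambdaSharp]
  intro σ d
  rw [h (d.support.map σ.toEmbedding) n _ (by rw [Finsupp.support_embDomain]),
    h d.support n d subset_rfl, Finset.prod_map]
  have : ∏ i ∈ d.support, w (σ.toEmbedding i) = PowerSeries.map
      (MvPowerSeries.rename (R := K) σ).toRingHom (∏ i ∈ d.support, w i) := by
    rw [map_prod]
    exact Finset.prod_congr rfl fun i _ => (hw σ i).symm
  rw [this, PowerSeries.coeff_map]
  exact MvPowerSeries.coeff_embDomain_rename σ.toEmbedding _ d

theorem map_inv_factor {τ : Type*} (φ : Series →ₐ[K] MvPowerSeries τ K) {i : ℕ} {j : τ}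
    (h : φ (MvPowerSeries.X i) = MvPowerSeries.X j) :
    φ (1 + MvPowerSeries.C β * MvPowerSeries.X i)⁻¹ =
      (1 + MvPowerSeries.C β * MvPowerSeries.X j)⁻¹ := by
  have hC : φ (MvPowerSeries.C β) = MvPowerSeries.C β := φ.commutes β
  have h1 : φ (1 + MvPowerSeries.C β * MvPowerSeries.X i) =
      1 + MvPowerSeries.C β * MvPowerSeries.X j := by
    rw [map_add, map_one, map_mul, hC, h]
  rw [algHom_inv φ (by simp) (by rw [h1]; simp), h1]

theorem q_mem_LambdaSharp (n : ℕ) : q n ∈ LambdaSharp := by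
  have := isInfProd_q.mem_LambdaSharp
    (fun σ i => map_factor (MvPowerSeries.rename σ) i (σ i) (MvPowerSeries.rename_X _ _)) n
  rwa [PowerSeries.coeff_mk] at this

theorem qTail_zero_mem_LambdaSharp : qTail 0 ∈ LambdaSharp := by
  have := isInfProd_qTail_zero.mem_LambdaSharp (fun σ i => by
    rw [PowerSeries.map_C, map_pow]
    exact congrArg (fun u => PowerSeries.C (u ^ 2))
      (map_inv_factor (MvPowerSeries.rename σ) (MvPowerSeries.rename_X _ _))) 0
  rwa [PowerSeries.coeff_zero_C] at this

theorem inv_mem_LambdaSharp {f : Series} (hf : f ∈ LambdaSharp)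
    (h0 : MvPowerSeries.constantCoeff f ≠ 0) : f⁻¹ ∈ LambdaSharp := by
  simp only [LambdaSharp, Algebra.mem_iInf] at hf ⊢
  intro σ
  have h : MvPowerSeries.rename (R := K) σ f = f := hf σ
  change MvPowerSeries.rename (R := K) σ f⁻¹ = f⁻¹
  rw [algHom_inv _ h0 (by rwa [h]), h]

theorem GQ_mem_LambdaSharp (n : ℕ) : GQ n ∈ LambdaSharp :=
  mul_mem (qTail_mem _ q_mem_LambdaSharp qTail_zero_mem_LambdaSharp n)
    (inv_mem_LambdaSharp qTail_zero_mem_LambdaSharp (by simp [constantCoeff_qTail_zero]))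

/-! ### Cancellation -/

theorem series_ext {f g : Series} (h : ∀ N, specialize N f = specialize N g) : f = g := by
  ext d
  refine specialize_eq_iff.1 (h (d.support.sup id + 1)) d fun i hi => ?_
  by_contra hne
  have := Finset.le_sup (f := id) (Finsupp.mem_support_iff.2 hne)
  simp only [id] at this
  omega

theorem IsInfProd.map_specialize {w : ℕ → PowerSeries Series} {W : PowerSeries Series}
    (h : IsInfProd w W) (N : ℕ) : PowerSeries.map (specialize N).toRingHom W =
      PowerSeries.map (specialize N).toRingHom (∏ i ∈ Finset.range N, w i) := by
  ext1 n
  rw [PowerSeries.coeff_map, PowerSeries.coeff_map]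
  refine specialize_eq_iff.2 fun d hd => h _ n d fun i hi => ?_
  rw [Finset.mem_range]
  by_contra hlt
  exact Finsupp.mem_support_iff.1 hi (hd i (by omega))

/-- The shift `x_i ↦ x_{i+2}` of the variables. -/
def shiftTwo : Series →ₐ[K] Series := MvPowerSeries.rename (addRightEmbedding 2 : ℕ ↪ ℕ)

theorem shiftTwo_X (i : ℕ) : shiftTwo (MvPowerSeries.X i) = MvPowerSeries.X (i + 2) :=
  MvPowerSeries.rename_X _ _

theorem specialize_shiftTwo {f g : Series} {N : ℕ} (h : specialize N f = specialize N g) :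
    specialize (N + 2) (shiftTwo f) = specialize (N + 2) (shiftTwo g) := by
  rw [specialize_eq_iff] at h ⊢
  intro d hd
  by_cases hr : ∃ e : ℕ →₀ ℕ, e.embDomain (addRightEmbedding 2) = d
  · obtain ⟨e, rfl⟩ := hr
    rw [shiftTwo, MvPowerSeries.coeff_embDomain_rename, MvPowerSeries.coeff_embDomain_rename]
    refine h e fun i hi => ?_
    have := hd (i + 2) (by omega)
    rwa [← Finsupp.embDomain_apply_self (addRightEmbedding 2) e i]
  · have hz : ∀ f : Series, MvPowerSeries.coeff d (shiftTwo f) = 0 := fun f =>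
      MvPowerSeries.coeff_rename_eq_zero _ _ fun ⟨e, he⟩ => hr ⟨e, by
        rw [← he, Finsupp.embDomain_eq_mapDomain]⟩
    rw [hz, hz]

theorem IsInfProd.eq_mul_shiftTwo {w : ℕ → PowerSeries Series} {W : PowerSeries Series}
    (h : IsInfProd w W)
    (hw : ∀ i, PowerSeries.map shiftTwo.toRingHom (w i) = w (i + 2)) :
    W = w 0 * w 1 * PowerSeries.map shiftTwo.toRingHom W := by
  have key : ∀ N, PowerSeries.map (specialize N).toRingHom W =
      PowerSeries.map (specialize N).toRingHom
        (w 0 * w 1 * PowerSeries.map shiftTwo.toRingHom W) := by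
    intro N
    -- With `N + 2` variables kept, the finite product is `w 0 * w 1` times the shift of the product
    -- of the first `N` factors. Forgetting two variables then gives the claim for `N`.
    have h2 : PowerSeries.map (specialize (N + 2)).toRingHom W =
      PowerSeries.map (specialize (N + 2)).toRingHom
        (w 0 * w 1 * PowerSeries.map shiftTwo.toRingHom W) := by
      rw [h.map_specialize, Finset.prod_range_succ', Finset.prod_range_succ',
        ← Finset.prod_congr rfl fun i _ => hw i, ← map_prod, mul_assoc, mul_comm, map_mul,
        map_mul _ (w 0 * w 1), zero_add, mul_comm (w 1)]
      congr 1
      ext1 n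
      simp only [PowerSeries.coeff_map]
      have := congrArg (PowerSeries.coeff n) (h.map_specialize N)
      simp only [PowerSeries.coeff_map] at this
      exact (specialize_shiftTwo this).symm
    ext1 n
    have := congrArg (PowerSeries.coeff n) h2
    simp only [PowerSeries.coeff_map] at this ⊢
    refine specialize_eq_iff.2 fun d hd => specialize_eq_iff.1 this d fun i hi => hd i (by omega)
  ext1 n
  refine series_ext fun N => ?_
  have := congrArg (PowerSeries.coeff n) (key N)
  simp only [PowerSeries.coeff_map] at this
  exact this

/-- The substitution `f ↦ f(t, t̄, x₃, x₄, …)`. -/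
abbrev cancelHom : Series →ₐ[K] MvPowerSeries (Option ℕ) K :=
  MvPowerSeries.substAlgHom hasSubst_cancelPoint

theorem cancelHom_X (i : ℕ) : cancelHom (MvPowerSeries.X i) = cancelPoint i :=
  MvPowerSeries.substAlgHom_X _ i

theorem cancelHom_shiftTwo (f : Series) : cancelHom (shiftTwo f) =
    MvPowerSeries.rename (Function.Embedding.some : ℕ ↪ Option ℕ) f := by
  rw [shiftTwo, MvPowerSeries.rename_eq_subst, MvPowerSeries.rename_eq_subst, cancelHom,
    MvPowerSeries.substAlgHom_apply,
    MvPowerSeries.subst_comp_subst_apply (MvPowerSeries.HasSubst.X_comp _) hasSubst_cancelPoint]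
  congr 1
  funext i
  simp only [Function.comp_apply]
  rw [MvPowerSeries.subst_X hasSubst_cancelPoint]
  rfl

/-- In `W = w 0 * w 1 * shiftTwo W` the substitution `t, t̄, x₃, …` turns the first two factors into
`1` and merely relabels the variables of the third, so `t` disappears. -/
theorem IsInfProd.mem_cancellation {w : ℕ → PowerSeries Series} {W : PowerSeries Series}
    (h : IsInfProd w W) (hw : ∀ i, PowerSeries.map shiftTwo.toRingHom (w i) = w (i + 2))
    (h1 : PowerSeries.map cancelHom.toRingHom (w 0 * w 1) = 1) (n : ℕ) :
    cancelHom (PowerSeries.coeff n W) =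
      MvPowerSeries.rename (Function.Embedding.some : ℕ ↪ Option ℕ) (PowerSeries.coeff n W) := by
  have h2 := congrArg (PowerSeries.map cancelHom.toRingHom) (h.eq_mul_shiftTwo hw)
  rw [map_mul, h1, one_mul] at h2
  have h3 := congrArg (PowerSeries.coeff n) h2
  simp only [PowerSeries.coeff_map] at h3
  exact h3.trans (cancelHom_shiftTwo _)

theorem constantCoeff_t :
    MvPowerSeries.constantCoeff (MvPowerSeries.X none : MvPowerSeries (Option ℕ) K) = 0 := by
  simp

/-- As `bar` is an involution, the first two factors become `(1 - t̄z)/(1 - tz)` and `(1 - tz)/(1 -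
t̄z)`. -/
theorem cancelHom_q (n : ℕ) : cancelHom (q n) =
    MvPowerSeries.rename (Function.Embedding.some : ℕ ↪ Option ℕ) (q n) := by
  have := isInfProd_q.mem_cancellation (fun i => map_factor _ _ _ (shiftTwo_X i)) ?_ n
  · rwa [PowerSeries.coeff_mk] at this
  set t : MvPowerSeries (Option ℕ) K := MvPowerSeries.X none with ht
  have hX0 : cancelHom (MvPowerSeries.X 0) = t := cancelHom_X 0
  have hX1 : cancelHom (MvPowerSeries.X 1) = bar t := cancelHom_X 1
  have hb0 : cancelHom (bar (MvPowerSeries.X 0)) = bar t := by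
    rw [algHom_bar _ (by simp) (by rw [hX0]; simp [ht]), hX0]
  have hb1 : cancelHom (bar (MvPowerSeries.X 1)) = t := by
    rw [algHom_bar _ (by simp) (by rw [hX1]; exact constantCoeff_bar constantCoeff_t), hX1,
      bar_bar constantCoeff_t]
  have h0 := congrArg (PowerSeries.map cancelHom.toRingHom) (factor_mul 0)
  have h1 := congrArg (PowerSeries.map cancelHom.toRingHom) (factor_mul 1)
  simp only [map_mul, map_sub, map_one, PowerSeries.map_C, PowerSeries.map_X,
    AlgHom.toRingHom_eq_coe, RingHom.coe_coe, hX0, hX1, hb0, hb1] at h0 h1 ⊢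
  refine mul_right_cancel₀ (mul_ne_zero (one_sub_ne_zero t) (one_sub_ne_zero (bar t))) ?_
  linear_combination (1 - PowerSeries.C t * PowerSeries.X) * h0 +
    PowerSeries.map (↑cancelHom) (factor 0) * (1 - PowerSeries.C t * PowerSeries.X) * h1

/-- Here the first two factors cancel because `(1 + βt)(1 + βt̄) = 1`. -/
theorem cancelHom_qTail_zero : cancelHom (qTail 0) =
    MvPowerSeries.rename (Function.Embedding.some : ℕ ↪ Option ℕ) (qTail 0) := by
  have := isInfProd_qTail_zero.mem_cancellation (fun i => by
    rw [PowerSeries.map_C, map_pow]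
    exact congrArg (fun u => PowerSeries.C (u ^ 2)) (map_inv_factor shiftTwo (shiftTwo_X i))) ?_ 0
  · rwa [PowerSeries.coeff_zero_C] at this
  set t : MvPowerSeries (Option ℕ) K := MvPowerSeries.X none with ht
  have hC : cancelHom (MvPowerSeries.C β) = MvPowerSeries.C β := cancelHom.commutes β
  have hX0 : cancelHom (MvPowerSeries.X 0) = t := cancelHom_X 0
  have hX1 : cancelHom (MvPowerSeries.X 1) = bar t := cancelHom_X 1
  have h0 := congrArg cancelHom (bar_spec (x := (MvPowerSeries.X 0 : Series)) (by simp))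
  have h1 := congrArg cancelHom (bar_spec (x := (MvPowerSeries.X 1 : Series)) (by simp))
  simp only [map_mul, map_add, map_one, hX0, hX1, hC] at h0 h1
  rw [one_add_mul_bar constantCoeff_t] at h1
  have h2 := bar_spec constantCoeff_t
  rw [← ht] at h1 h2
  have h3 : cancelHom (1 + MvPowerSeries.C β * MvPowerSeries.X 0)⁻¹ *
      cancelHom (1 + MvPowerSeries.C β * MvPowerSeries.X 1)⁻¹ = 1 := by
    linear_combination
      cancelHom (1 + MvPowerSeries.C β * MvPowerSeries.X 1)⁻¹ *
          (1 + MvPowerSeries.C β * t)⁻¹ * h0 + h1 -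
        cancelHom (1 + MvPowerSeries.C β * MvPowerSeries.X 0)⁻¹ *
          cancelHom (1 + MvPowerSeries.C β * MvPowerSeries.X 1)⁻¹ * h2
  rw [← map_mul, PowerSeries.map_C, ← mul_pow, map_pow, map_mul]
  exact (congrArg (fun u => PowerSeries.C (u ^ 2)) h3).trans (by simp)

theorem inv_mem_cancellation {f : Series} (h0 : MvPowerSeries.constantCoeff f ≠ 0)
    (hf : cancelHom f = MvPowerSeries.rename (Function.Embedding.some : ℕ ↪ Option ℕ) f) :
    f⁻¹ ∈ cancellation := by
  refine ⟨f⁻¹, ?_⟩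
  have h1 : MvPowerSeries.constantCoeff
      (MvPowerSeries.rename (Function.Embedding.some : ℕ ↪ Option ℕ) f) ≠ 0 := by simpa using h0
  change MvPowerSeries.rename (Function.Embedding.some : ℕ ↪ Option ℕ) f⁻¹ = cancelHom f⁻¹
  rw [algHom_inv _ h0 h1, algHom_inv _ h0 (by rwa [hf]), hf]

theorem GQ_mem_cancellation (n : ℕ) : GQ n ∈ cancellation :=
  mul_mem (qTail_mem cancellation (fun n => ⟨q n, (cancelHom_q n).symm⟩)
    ⟨qTail 0, cancelHom_qTail_zero.symm⟩ n)
    (inv_mem_cancellation (by simp [constantCoeff_qTail_zero]) cancelHom_qTail_zero)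

/-! ### Polynomiality of the specializations -/

theorem qTail_zero_mul_inv : qTail 0 * (qTail 0)⁻¹ = 1 :=
  MvPowerSeries.mul_inv_cancel _ (by simp [constantCoeff_qTail_zero])

theorem GQ_recursion (n : ℕ) :
    GQ n + MvPowerSeries.C β * GQ (n + 1) = (qTail 0)⁻¹ * q n := by
  have hβ : β ≠ 0 := RatFunc.X_ne_zero
  rw [GQ, GQ, qTail_succ, ← MvPowerSeries.smul_eq_C_mul, smul_mul_assoc, smul_smul,
    mul_inv_cancel₀ hβ, one_smul]
  ring

theorem GQ_zero : GQ 0 = 1 := qTail_zero_mul_inv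

/-- This is the defining generating function multiplied by `1 + βz⁻¹`, with only the nonnegative
powers of `z` kept; the summand `1` is `GQ 0`. -/
theorem generating_GQ :
    1 + (PowerSeries.X + PowerSeries.C (MvPowerSeries.C β)) *
      PowerSeries.mk (fun n => GQ (n + 1)) =
    PowerSeries.C (qTail 0)⁻¹ * PowerSeries.mk q := by
  ext1 n
  rw [PowerSeries.coeff_C_mul, PowerSeries.coeff_mk, ← GQ_recursion, map_add, add_mul, map_add,
    PowerSeries.coeff_C_mul, PowerSeries.coeff_mk, ← add_assoc]
  congr 1
  cases n with
  | zero => simp [GQ_zero]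
  | succ n => simp [PowerSeries.coeff_one, PowerSeries.coeff_succ_X_mul]

theorem specialize_X {N : ℕ} (i : Fin N) :
    specialize N (MvPowerSeries.X (i : ℕ)) = MvPowerSeries.X i :=
  MvPowerSeries.killCompl_X (e := Fin.valEmbedding) i

theorem map_specialize_q (N : ℕ) :
    PowerSeries.map (specialize N).toRingHom (PowerSeries.mk q) = ∏ i : Fin N, factor i := by
  rw [isInfProd_q.map_specialize, map_prod, Finset.prod_range]
  exact Finset.prod_congr rfl fun i _ => map_factor _ _ _ (specialize_X i)

theorem specialize_qTail_zero (N : ℕ) : specialize N (qTail 0) =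
    ∏ i : Fin N, ((1 + MvPowerSeries.C β * MvPowerSeries.X i)⁻¹) ^ 2 := by
  have h := congrArg (PowerSeries.coeff 0) (isInfProd_qTail_zero.map_specialize N)
  rw [PowerSeries.coeff_map, PowerSeries.coeff_map, ← map_prod, PowerSeries.coeff_zero_C,
    PowerSeries.coeff_zero_C] at h
  refine h.trans ?_
  rw [map_prod, Finset.prod_range]
  refine Finset.prod_congr rfl fun i _ => ?_
  rw [map_pow]
  exact congrArg (· ^ 2) (map_inv_factor _ (specialize_X i))

theorem specialize_qTail_zero_inv (N : ℕ) : specialize N (qTail 0)⁻¹ =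
    ∏ i : Fin N, (1 + MvPowerSeries.C β * MvPowerSeries.X i) ^ 2 := by
  have h1 := congrArg (specialize N) qTail_zero_mul_inv
  rw [map_mul, map_one, specialize_qTail_zero] at h1
  have h2 : (∏ i : Fin N, (1 + MvPowerSeries.C β * MvPowerSeries.X i) ^ 2) *
      ∏ i : Fin N, ((1 + MvPowerSeries.C β * MvPowerSeries.X i : MvPowerSeries (Fin N) K)⁻¹) ^ 2
        = 1 := by
    rw [← Finset.prod_mul_distrib]
    refine Finset.prod_eq_one fun i _ => ?_
    rw [← mul_pow, bar_spec (by simp), one_pow]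
  linear_combination (∏ i : Fin N, (1 + MvPowerSeries.C β * MvPowerSeries.X i) ^ 2) * h1 -
    (specialize N (qTail 0)⁻¹) * h2

/-- The inclusion of `ℤ[β][x₁, …, x_N]` into the power series over `ℚ(β)`. -/
def polyToSeries (N : ℕ) :
    MvPolynomial (Fin N) (Polynomial ℤ) →+* MvPowerSeries (Fin N) K :=
  (MvPolynomial.coeToMvPowerSeries.ringHom).comp (MvPolynomial.map intPolyToK)

theorem polyToSeries_apply {N : ℕ} (P : MvPolynomial (Fin N) (Polynomial ℤ)) :
    polyToSeries N P = ((MvPolynomial.map intPolyToK P : MvPolynomial (Fin N) K) :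
      MvPowerSeries (Fin N) K) := rfl

theorem polyToSeries_X {N : ℕ} (i : Fin N) :
    polyToSeries N (MvPolynomial.X i) = MvPowerSeries.X i := by
  rw [polyToSeries_apply, MvPolynomial.map_X, MvPolynomial.coe_X]

theorem polyToSeries_C {N : ℕ} :
    polyToSeries N (MvPolynomial.C Polynomial.X) = MvPowerSeries.C β := by
  rw [polyToSeries_apply, MvPolynomial.map_C, MvPolynomial.coe_C]
  congr 1
  exact Polynomial.aeval_X β

/-- The specialization of `GQ (n + 1)` lies in every ring that contains `β` and the variables. -/
theorem specialize_GQ_mem_range {A : Type*} [CommRing A] (n : ℕ) {N : ℕ}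
    (φ : A →+* MvPowerSeries (Fin N) K) (x : Fin N → A) (hx : ∀ i, φ (x i) = MvPowerSeries.X i)
    (b : A) (hb : φ b = MvPowerSeries.C β) : ∃ P : A, specialize N (GQ (n + 1)) = φ P := by
  -- Per variable, `(1 + βx)² (1 - x̄z) = (1 + βx)(1 + (z + β)x)`. Thus `P / D` represents `Q(z) /
  -- Q(-β)` without any `x̄`.
  set P : Polynomial A :=
    ∏ i : Fin N, ((1 + Polynomial.C (b * x i)) *
      (1 + (Polynomial.X + Polynomial.C b) * Polynomial.C (x i))) with hP
  set D : Polynomial A :=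
    ∏ i : Fin N, (1 - Polynomial.C (x i) * Polynomial.X) with hD
  -- At `z = -b` both products become `∏ (1 + b x_i)`. This carries out the division by `z + β`
  -- inside `A[z]`.
  obtain ⟨S, hS⟩ : (Polynomial.X - Polynomial.C (-b)) ∣ P - D := by
    rw [Polynomial.dvd_iff_isRoot, Polynomial.IsRoot, Polynomial.eval_sub, sub_eq_zero, hP, hD,
      Polynomial.eval_prod, Polynomial.eval_prod]
    refine Finset.prod_congr rfl fun i _ => ?_
    simp
    ring
  set j : Polynomial A →+*
      PowerSeries (MvPowerSeries (Fin N) K) :=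
    (PowerSeries.map φ).comp Polynomial.coeToPowerSeries.ringHom with hj
  have hjX : j Polynomial.X = PowerSeries.X := by simp [hj]
  have hjC : ∀ a, j (Polynomial.C a) = PowerSeries.C (φ a) := by simp [hj]
  have hjP : j P = PowerSeries.C (specialize N (qTail 0)⁻¹) *
      (PowerSeries.map (specialize N).toRingHom (PowerSeries.mk q) * j D) := by
    rw [specialize_qTail_zero_inv, map_specialize_q, hP, hD, map_prod, map_prod, map_prod,
      ← Finset.prod_mul_distrib, ← Finset.prod_mul_distrib]
    refine Finset.prod_congr rfl fun i _ => ?_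
    simp only [map_mul, map_add, map_sub, map_one, hjX, hjC, hx, hb,
      map_pow]
    rw [factor_mul i]
    have h1 := congrArg PowerSeries.C (bar_spec (x := (MvPowerSeries.X i : MvPowerSeries (Fin N) K))
      (by simp))
    rw [bar]
    simp only [map_mul, map_add, map_one, map_neg] at h1 ⊢
    linear_combination (-(1 + PowerSeries.C (MvPowerSeries.C β) *
      PowerSeries.C (MvPowerSeries.X i)) * PowerSeries.C (MvPowerSeries.X i) * PowerSeries.X) * h1
  have hgen := congrArg (PowerSeries.map (specialize N).toRingHom) generating_GQ
  have hCβ : (specialize N).toRingHom (MvPowerSeries.C β) = MvPowerSeries.C β :=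
    (specialize N).commutes β
  simp only [map_add, map_mul, map_one, PowerSeries.map_X, PowerSeries.map_C, hCβ] at hgen
  set G := PowerSeries.map (specialize N).toRingHom (PowerSeries.mk fun n => GQ (n + 1)) with hG
  have hjS := congrArg j hS
  rw [map_sub, map_mul, map_sub, hjX, hjC, map_neg, hb, map_neg, sub_neg_eq_add] at hjS
  have hz : (PowerSeries.X + PowerSeries.C (MvPowerSeries.C β) :
      PowerSeries (MvPowerSeries (Fin N) K)) ≠ 0 := by
    intro h
    have := congrArg (PowerSeries.coeff 1) h
    simp at this
  have hGD : G * j D = j S := by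
    refine mul_left_cancel₀ hz ?_
    rw [← hjS, hjP]
    have : PowerSeries.C (specialize N (qTail 0)⁻¹) *
      PowerSeries.map (specialize N).toRingHom (PowerSeries.mk q) = _ := hgen.symm
    linear_combination -(j D) * this
  have hD0 : PowerSeries.constantCoeff
      (D : PowerSeries A) = 1 := by
    rw [← PowerSeries.coeff_zero_eq_constantCoeff_apply, Polynomial.coeff_coe,
      Polynomial.coeff_zero_eq_eval_zero, hD, Polynomial.eval_prod]
    simp
  -- `D` has constant term `1`, so the quotient `S / D` exists over `A` itself.
  set F : PowerSeries A :=
    (S : PowerSeries A) *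
      PowerSeries.invOfUnit (D : PowerSeries A) 1 with hF
  have hFD : F * (D : PowerSeries A) = S := by
    rw [hF, mul_assoc, PowerSeries.invOfUnit_mul _ _ (by simp [hD0]), mul_one]
  have hFD' : PowerSeries.map φ F * j D = j S := by
    have := congrArg (PowerSeries.map φ) hFD
    rwa [map_mul] at this
  have hjD : j D ≠ 0 := by
    intro h
    have := congrArg PowerSeries.constantCoeff h
    rw [map_zero] at this
    change PowerSeries.constantCoeff (PowerSeries.map φ _) = 0 at this
    rw [← PowerSeries.coeff_zero_eq_constantCoeff_apply, PowerSeries.coeff_map,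
      PowerSeries.coeff_zero_eq_constantCoeff_apply] at this
    change φ (PowerSeries.constantCoeff
      (D : PowerSeries A)) = 0 at this
    rw [hD0, map_one] at this
    exact one_ne_zero this
  have hGF : G = PowerSeries.map φ F :=
    mul_right_cancel₀ hjD (hGD.trans hFD'.symm)
  refine ⟨PowerSeries.coeff n F, ?_⟩
  have := congrArg (PowerSeries.coeff n) hGF
  rwa [hG, PowerSeries.coeff_map, PowerSeries.coeff_map, PowerSeries.coeff_mk] at this

theorem specialize_GQ_polynomial (n N : ℕ) :
    ∃ P : MvPolynomial (Fin N) (Polynomial ℤ), specialize N (GQ (n + 1)) = polyToSeries N P :=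
  specialize_GQ_mem_range n (polyToSeries N) _ polyToSeries_X _ polyToSeries_C

/-! ### Rearranging exponents and membership in `Λ̂` -/

/-- The nonzero exponents of a monomial. -/
def exponents (d : ℕ →₀ ℕ) : Multiset ℕ := d.support.val.map d

/-- Equal multisets of exponents give an exponent-preserving matching of the two finite supports,
and a bijection between finite subsets of `ℕ` extends to a permutation because `Equiv.Perm ℕ` is
multiply transitive. -/
theorem exists_perm_of_exponents_eq {d e : ℕ →₀ ℕ} (h : exponents d = exponents e) :
    ∃ σ : Equiv.Perm ℕ, d.embDomain σ.toEmbedding = e := by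
  have h1 : List.Perm (d.support.toList.map d) (e.support.toList.map e) := by
    rw [← Multiset.coe_eq_coe, ← Multiset.map_coe, ← Multiset.map_coe, Finset.coe_toList,
      Finset.coe_toList]
    exact h
  -- `w` lists the support of `e` in the order in which its exponents match those of `d`.
  obtain ⟨w, hw, hwe⟩ := (congrFun (congrFun (List.eq_map_comp_perm e) _) _).mpr h1
  have hlen : d.support.toList.length = w.length := by simpa using congrArg List.length hw
  have hnd : w.Nodup := hwe.nodup_iff.2 (Finset.nodup_toList _)
  let x : Fin w.length ↪ ℕ := ⟨fun i => d.support.toList[i], fun i j hij => by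
    have := (Finset.nodup_toList d.support).getElem_inj_iff.1 hij
    exact Fin.ext this⟩
  let y : Fin w.length ↪ ℕ := ⟨fun i => w[i], fun i j hij =>
    Fin.ext (hnd.getElem_inj_iff.1 hij)⟩
  obtain ⟨σ, hσ⟩ := (Equiv.Perm.isMultiplyPretransitive ℕ w.length).exists_smul_eq x y
  have hσ' : ∀ i (hi : i < w.length), σ (d.support.toList[i]) = w[i] := fun i hi =>
    DFunLike.congr_fun hσ ⟨i, hi⟩
  refine ⟨σ, ?_⟩
  ext k
  obtain ⟨j, rfl⟩ := σ.surjective k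
  rw [← Equiv.coe_toEmbedding, Finsupp.embDomain_apply_self, Equiv.coe_toEmbedding]
  by_cases hj : j ∈ d.support
  · obtain ⟨i, hi, rfl⟩ := List.mem_iff_getElem.1 (Finset.mem_toList.2 hj)
    rw [hσ' i (by omega)]
    have := List.getElem_of_eq hw (i := i) (by simpa using hi)
    simpa using this
  · rw [Finsupp.notMem_support_iff.1 hj]
    symm
    by_contra hne
    have hmem : σ j ∈ w := hwe.mem_iff.2 (Finset.mem_toList.2 (Finsupp.mem_support_iff.2 hne))
    obtain ⟨i, hi, hij⟩ := List.mem_iff_getElem.1 hmem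
    rw [← hσ' i hi] at hij
    have := σ.injective hij
    exact hj (this ▸ Finset.mem_toList.1 (List.getElem_mem _))

theorem coeff_eq_of_exponents_eq {f : Series} (hf : f ∈ LambdaSharp) {d e : ℕ →₀ ℕ}
    (h : exponents d = exponents e) : MvPowerSeries.coeff d f = MvPowerSeries.coeff e f := by
  obtain ⟨σ, rfl⟩ := exists_perm_of_exponents_eq h
  exact (mem_LambdaSharp.1 hf σ d).symm

theorem sum_exponents (d : ℕ →₀ ℕ) : (exponents d).sum = d.degree := rfl

theorem card_exponents (d : ℕ →₀ ℕ) : (exponents d).card = d.support.card := by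
  simp [exponents]

theorem exponents_embDomain (σ : ℕ ↪ ℕ) (d : ℕ →₀ ℕ) :
    exponents (d.embDomain σ) = exponents d := by
  rw [exponents, exponents, Finsupp.support_embDomain, Finset.map_val, Multiset.map_map]
  exact Multiset.map_congr rfl fun i _ => Finsupp.embDomain_apply_self σ d i

/-- The monomial with the given exponents in `x₁, x₂, …`, in this order. -/
def monomialOfList (l : List ℕ) : ℕ →₀ ℕ :=
  Finsupp.onFinset (Finset.range l.length) (fun i => l.getD i 0) fun i hi => by
    rw [Finset.mem_range]
    by_contra h
    exact hi (List.getD_eq_default _ _ (by omega))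

theorem exponents_monomialOfList {l : List ℕ} (hl : 0 ∉ l) : exponents (monomialOfList l) = l := by
  have hs : (monomialOfList l).support = Finset.range l.length := by
    ext i
    rw [Finsupp.mem_support_iff, Finset.mem_range]
    change l.getD i 0 ≠ 0 ↔ _
    constructor
    · intro h
      by_contra h'
      exact h (List.getD_eq_default _ _ (by omega))
    · intro h h0
      rw [List.getD_eq_getElem _ _ h] at h0
      exact hl (h0 ▸ List.getElem_mem h)
  rw [exponents, hs, Finset.range_val]
  change Multiset.map (fun i => l.getD i 0) (List.range l.length : Multiset ℕ) = _
  rw [Multiset.map_coe]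
  congr 1
  refine List.ext_getElem (by simp) fun i h1 h2 => ?_
  simp [h2]

/-- Keeping only the monomials of `f` in at most `N` variables changes neither symmetry nor the
specialization to `N` variables. The result has bounded degree: any such monomial can be moved into
`x₁, …, x_N`, where the polynomial `P` bounds its degree. -/
theorem mem_LambdaHat_of_polynomial {f : Series} (hf : f ∈ LambdaSharp)
    (h : ∀ N, ∃ P : MvPolynomial (Fin N) K, specialize N f = (P : MvPowerSeries (Fin N) K)) :
    f ∈ LambdaHat := by
  refine ⟨hf, ?_⟩
  simp only [SetLike.mem_coe, Algebra.mem_iInf]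
  intro N
  obtain ⟨P, hP⟩ := h N
  set g : Series := fun d => if d.support.card ≤ N then MvPowerSeries.coeff d f else 0 with hg
  have hgc : ∀ d, MvPowerSeries.coeff d g =
      if d.support.card ≤ N then MvPowerSeries.coeff d f else 0 := fun d => rfl
  refine ⟨g, ⟨?_, ?_⟩, ?_⟩
  · refine mem_LambdaSharp.2 fun σ d => ?_
    rw [hgc, hgc, Finsupp.support_embDomain, Finset.card_map, mem_LambdaSharp.1 hf]
  · refine ⟨P.totalDegree, fun d hd => ?_⟩
    rw [hgc]
    split_ifs with hc
    · have hl : (exponents d).toList.length ≤ N := by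
        rwa [Multiset.length_toList, card_exponents]
      have h0 : 0 ∉ (exponents d).toList := by
        simp [exponents]
      have hexp : exponents d = exponents (monomialOfList (exponents d).toList) := by
        rw [exponents_monomialOfList h0, Multiset.coe_toList]
      rw [coeff_eq_of_exponents_eq hf hexp]
      obtain ⟨e, he⟩ : ∃ e : Fin N →₀ ℕ, e.embDomain Fin.valEmbedding =
          monomialOfList (exponents d).toList := by
        refine ⟨_, Finsupp.embDomain_comapDomain (f := Fin.valEmbedding) fun i hi => ?_⟩
        have := Finsupp.support_onFinset_subset hi
        simp only [Finset.mem_range] at this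
        exact ⟨⟨i, by omega⟩, rfl⟩
      have hc := congrArg (MvPowerSeries.coeff e) hP
      rw [specialize, MvPowerSeries.coeff_killCompl, he, MvPolynomial.coeff_coe] at hc
      rw [hc]
      refine MvPolynomial.coeff_eq_zero_of_totalDegree_lt ?_
      refine hd.trans_eq ?_
      rw [← sum_exponents, hexp, ← he, sum_exponents, Finsupp.embDomain_eq_mapDomain,
        Finsupp.degree_mapDomain]
      rfl
    · rfl
  · refine specialize_eq_iff.2 fun d hd => ?_
    rw [hgc, if_pos]
    refine (Finset.card_le_card (t := Finset.range N) fun i hi => ?_).trans_eq (by simp)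
    rw [Finset.mem_range]
    by_contra h
    exact Finsupp.mem_support_iff.1 hi (hd i (by omega))

theorem GQ_mem_GGamma (n : ℕ) : GQ (n + 1) ∈ GGamma := by
  refine ⟨mem_LambdaHat_of_polynomial (GQ_mem_LambdaSharp _) fun N => ?_, GQ_mem_cancellation _⟩
  obtain ⟨P, hP⟩ := specialize_GQ_polynomial n N
  exact ⟨MvPolynomial.map intPolyToK P, hP⟩

/-! ### The filtration by degree -/

/-- Power series without terms of degree less than `k`. -/
def orderGE (k : ℕ) : Submodule K Series where
  carrier := {f | ∀ d : ℕ →₀ ℕ, d.degree < k → MvPowerSeries.coeff d f = 0}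
  zero_mem' := fun d _ => map_zero _
  add_mem' := fun hf hg d hd => by rw [map_add, hf d hd, hg d hd, add_zero]
  smul_mem' := fun a f hf d hd => by rw [MvPowerSeries.coeff_smul, hf d hd, mul_zero]

theorem orderGE_anti {j k : ℕ} (h : j ≤ k) : orderGE k ≤ orderGE j :=
  fun _ hf d hd => hf d (hd.trans_le h)

theorem mul_mem_orderGE {j k : ℕ} {f g : Series} (hf : f ∈ orderGE j) (hg : g ∈ orderGE k) :
    f * g ∈ orderGE (j + k) := by
  classical
  intro d hd
  rw [MvPowerSeries.coeff_mul]
  refine Finset.sum_eq_zero fun e he => ?_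
  rw [Finset.HasAntidiagonal.mem_antidiagonal] at he
  have hdeg : e.1.degree + e.2.degree = d.degree := by rw [← he, map_add]
  by_cases h1 : e.1.degree < j
  · rw [hf _ h1, zero_mul]
  · rw [hg _ (by omega), mul_zero]

theorem coeff_X_mul_series (a : ℕ) (d : ℕ →₀ ℕ) (f : Series) :
    MvPowerSeries.coeff d (MvPowerSeries.X a * f) =
      if 1 ≤ d a then MvPowerSeries.coeff (d - Finsupp.single a 1) f else 0 := by
  classical
  rw [MvPowerSeries.X, MvPowerSeries.coeff_monomial_mul]
  simp only [Finsupp.single_le_iff, one_mul]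

/-! ### Leading terms of `q_n` and `GQ_n` -/

theorem coeff_evalZ_one_zero (F : PowerSeries Series) (d : ℕ →₀ ℕ) :
    MvPowerSeries.coeff d (evalZ 1 0 F) =
      MvPowerSeries.coeff d (PowerSeries.coeff d.degree F) := by
  rw [coeff_evalZ, Finset.sum_eq_single d.degree]
  · simp
  · intro n hn hne
    rw [Finset.mem_range] at hn
    rw [zero_pow (by omega), mul_zero, zero_mul]
  · simp

theorem evalZ_linear {i : ℕ} {u : Series} :
    evalZ 1 0 (PowerSeries.C (MvPowerSeries.X i * u) * PowerSeries.X) =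
      MvPowerSeries.C (MvPowerSeries.constantCoeff u) * MvPowerSeries.X i := by
  classical
  ext d
  rw [coeff_evalZ_one_zero, coeff_C_mul', PowerSeries.coeff_C_mul, PowerSeries.coeff_X,
    MvPowerSeries.coeff_X]
  by_cases h1 : d = Finsupp.single i 1
  · subst h1
    simp [coeff_X_mul_series]
  · rw [if_neg h1]
    split_ifs with hd
    · rw [mul_one, coeff_X_mul_series]
      split_ifs with h2
      · exfalso
        apply h1
        have h3 : d - Finsupp.single i 1 + Finsupp.single i 1 = d :=
          tsub_add_cancel_of_le (Finsupp.single_le_iff.2 h2)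
        have h4 := congrArg Finsupp.degree h3
        rw [map_add, hd, Finsupp.degree_single] at h4
        have h5 : d - Finsupp.single i 1 = 0 := by
          rw [← Finsupp.degree_eq_zero_iff]; omega
        rw [← h3, h5, zero_add]
      · simp
    · simp

/-- Since `x̄ = -x + ⋯`, the part of `(1 - x̄z)/(1 - xz)` in which the degrees in `z` and `x` agree
is `(1 + xz)/(1 - xz)`, here at `z = 1`. -/
theorem evalZ_one_zero_factor (i : ℕ) :
    (1 - MvPowerSeries.X i) * evalZ 1 0 (factor i) = 1 + MvPowerSeries.X i := by
  have h := congrArg (evalZ 1 0) (factor_mul i)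
  have hX : MvPowerSeries.constantCoeff (MvPowerSeries.X i : Series) = 0 := by simp
  have h1 := evalZ_linear (i := i) (u := 1)
  have h2 := evalZ_linear (i := i) (u := -(1 + MvPowerSeries.C β * MvPowerSeries.X i : Series)⁻¹)
  rw [mul_one] at h1
  rw [show MvPowerSeries.X i * -(1 + MvPowerSeries.C β * MvPowerSeries.X i : Series)⁻¹ =
    bar (MvPowerSeries.X i) by rw [bar]; ring] at h2
  rw [evalZ_mul _ _ (filtered_factor i) (Filtered.one.sub (Filtered.C_mul_X hX)), evalZ_sub,
    evalZ_sub, evalZ_one, h1, h2] at h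
  simp at h
  linear_combination h

/-- The product over `i ∈ s` of `(1 + x_i) / (1 - x_i)`. -/
def signedProd (s : Finset ℕ) : Series :=
  fun d => if d.support ⊆ s then 2 ^ d.support.card else 0

theorem coeff_signedProd (s : Finset ℕ) (d : ℕ →₀ ℕ) : MvPowerSeries.coeff d (signedProd s) =
    if d.support ⊆ s then 2 ^ d.support.card else 0 := rfl

/-- The expansion `(1 + x)/(1 - x) = 1 + 2x + 2x² + ⋯` explains the factor `2` for each variable
that occurs; the relation is stated without division. -/
theorem signedProd_insert {a : ℕ} {s : Finset ℕ} (ha : a ∉ s) :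
    (1 - MvPowerSeries.X a) * signedProd (insert a s) =
      (1 + MvPowerSeries.X a) * signedProd s := by
  classical
  ext d
  rw [sub_mul, add_mul, one_mul, one_mul, map_sub, map_add, coeff_X_mul_series,
    coeff_X_mul_series]
  simp only [coeff_signedProd]
  by_cases h : 1 ≤ d a
  · obtain ⟨e, rfl⟩ : ∃ e, d = e + Finsupp.single a 1 :=
      ⟨d - Finsupp.single a 1, (tsub_add_cancel_of_le (Finsupp.single_le_iff.2 h)).symm⟩
    rw [if_pos h, if_pos h, add_tsub_cancel_right]
    have hs : (e + Finsupp.single a 1).support = insert a e.support := by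
      ext i
      by_cases hi : i = a
      · subst hi; simp
      · simp [hi]
    rw [hs, if_neg (c := insert a e.support ⊆ s) fun h' => ha (h' (Finset.mem_insert_self _ _))]
    by_cases hea : a ∈ e.support
    · rw [Finset.insert_eq_of_mem hea, if_neg (c := e.support ⊆ s) fun h' => ha (h' hea)]
      ring
    · have h1 : e.support ⊆ insert a s ↔ e.support ⊆ s :=
        Finset.subset_insert_iff_of_notMem hea
      have h2 : insert a e.support ⊆ insert a s ↔ e.support ⊆ s := by
        rw [Finset.insert_subset_iff, h1]
        simp
      rw [Finset.card_insert_of_notMem hea]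
      simp only [h1, h2]
      split_ifs
      · ring
      · ring
  · rw [if_neg h, if_neg h, sub_zero, add_zero]
    have hea : a ∉ d.support := by simp; omega
    simp only [Finset.subset_insert_iff_of_notMem hea]

theorem prod_evalZ_factor (s : Finset ℕ) : ∏ i ∈ s, evalZ 1 0 (factor i) = signedProd s := by
  classical
  induction s using Finset.induction_on with
  | empty =>
    ext d
    rw [Finset.prod_empty, coeff_signedProd, MvPowerSeries.coeff_one]
    by_cases hd : d = 0
    · simp [hd]
    · simp [hd]
  | insert a s ha ih =>
    have h1 : (1 - MvPowerSeries.X a : Series) ≠ 0 := by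
      intro h
      have := congrArg MvPowerSeries.constantCoeff h
      simp at this
    refine mul_left_cancel₀ h1 ?_
    rw [Finset.prod_insert ha, ih, ← mul_assoc, evalZ_one_zero_factor, signedProd_insert ha]

theorem coeff_q_of_degree_eq {n : ℕ} {d : ℕ →₀ ℕ} (h : d.degree = n) :
    MvPowerSeries.coeff d (q n) = 2 ^ d.support.card := by
  have h1 := isInfProd_q d.support n d subset_rfl
  rw [PowerSeries.coeff_mk, ← h, ← coeff_evalZ_one_zero,
    evalZ_prod _ _ _ fun i _ => filtered_factor i, prod_evalZ_factor, coeff_signedProd,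
    if_pos subset_rfl] at h1
  rw [← h, h1]

/-- Schur's `q`-function of degree `n`. -/
def schurQ (n : ℕ) : Series := fun d => if d.degree = n then 2 ^ d.support.card else 0

theorem coeff_schurQ (n : ℕ) (d : ℕ →₀ ℕ) : MvPowerSeries.coeff d (schurQ n) =
    if d.degree = n then 2 ^ d.support.card else 0 := rfl

theorem schurQ_mem_orderGE (n : ℕ) : schurQ n ∈ orderGE n := fun d hd => by
  rw [coeff_schurQ, if_neg hd.ne]

theorem q_sub_schurQ_mem (n : ℕ) : q n - schurQ n ∈ orderGE (n + 1) := by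
  intro d hd
  rw [map_sub, coeff_schurQ]
  split_ifs with h
  · rw [coeff_q_of_degree_eq h, sub_self]
  · rw [coeff_q_eq_zero (by omega), sub_zero]

theorem q_mem_orderGE (n : ℕ) : q n ∈ orderGE n := fun _ hd => coeff_q_eq_zero hd

theorem qTail_sub_q_mem (n : ℕ) : qTail n - q n ∈ orderGE (n + 1) := by
  intro d hd
  rw [map_sub, coeff_qTail n d 1 hd]
  simp

/-- Three errors of higher degree add up: `Q(-β)⁻¹` differs from `1` in positive degree only, the
tail differs from `q n` by terms with `l ≥ 1`, and `q n` differs from its lowest form. -/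
theorem GQ_sub_schurQ_mem (n : ℕ) : GQ n - schurQ n ∈ orderGE (n + 1) := by
  have h1 := qTail_sub_q_mem n
  have h2 : qTail n ∈ orderGE n := by
    have := (orderGE n).add_mem (orderGE_anti n.le_succ h1) (q_mem_orderGE n)
    rwa [sub_add_cancel] at this
  have h3 : (qTail 0)⁻¹ - 1 ∈ orderGE 1 := by
    intro d hd
    obtain rfl : d = 0 := by
      rw [← Finsupp.degree_eq_zero_iff]; omega
    simp [constantCoeff_qTail_zero]
  have h4 := (orderGE (n + 1)).add_mem ((orderGE (n + 1)).add_mem (mul_mem_orderGE h2 h3) h1)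
    (q_sub_schurQ_mem n)
  convert h4 using 1
  rw [GQ]
  ring

theorem GQ_mem_orderGE (n : ℕ) : GQ n ∈ orderGE n := by
  have := (orderGE n).add_mem (orderGE_anti n.le_succ (GQ_sub_schurQ_mem n))
    (schurQ_mem_orderGE n)
  rwa [sub_add_cancel] at this

/-- Products of Schur's `q`-functions. -/
def schurQProd (μ : Multiset ℕ) : Series := (μ.map schurQ).prod

theorem GQ_prod_leading (μ : Multiset ℕ) :
    (μ.map GQ).prod ∈ orderGE μ.sum ∧ schurQProd μ ∈ orderGE μ.sum ∧
      (μ.map GQ).prod - schurQProd μ ∈ orderGE (μ.sum + 1) := by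
  induction μ using Multiset.induction_on with
  | empty => exact ⟨fun d hd => by simp at hd, fun d hd => by simp at hd, by simp [schurQProd]⟩
  | cons a μ ih =>
    obtain ⟨h1, h2, h3⟩ := ih
    simp only [schurQProd, Multiset.map_cons, Multiset.prod_cons, Multiset.sum_cons] at h2 h3 ⊢
    -- For the difference of products, use `GA - qB = (G - q)A + q(A - B)`.
    refine ⟨mul_mem_orderGE (GQ_mem_orderGE a) h1, mul_mem_orderGE (schurQ_mem_orderGE a) h2, ?_⟩
    have h4 := mul_mem_orderGE (GQ_sub_schurQ_mem a) h1
    have h5 := mul_mem_orderGE (schurQ_mem_orderGE a) h3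
    rw [show a + 1 + μ.sum = a + μ.sum + 1 by ring] at h4
    rw [← add_assoc] at h5
    convert (orderGE (a + μ.sum + 1)).add_mem h4 h5 using 1
    ring

theorem coeff_schurQProd_of_ne {μ : Multiset ℕ} {d : ℕ →₀ ℕ} (h : d.degree ≠ μ.sum) :
    MvPowerSeries.coeff d (schurQProd μ) = 0 := by
  classical
  induction μ using Multiset.induction_on generalizing d with
  | empty =>
    rw [schurQProd, Multiset.map_zero, Multiset.prod_zero, MvPowerSeries.coeff_one, if_neg]
    rintro rfl
    simp at h
  | cons a μ ih =>
    rw [schurQProd, Multiset.map_cons, Multiset.prod_cons, MvPowerSeries.coeff_mul]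
    refine Finset.sum_eq_zero fun e he => ?_
    rw [Finset.HasAntidiagonal.mem_antidiagonal] at he
    have hdeg : e.1.degree + e.2.degree = d.degree := by rw [← he, map_add]
    rw [Multiset.sum_cons] at h
    by_cases h1 : e.1.degree = a
    · have h2 := ih (d := e.2) (by omega)
      rw [schurQProd] at h2
      rw [h2, mul_zero]
    · rw [coeff_schurQ, if_neg h1, zero_mul]

/-! ### Power sums -/

/-- The power sum `∑_i x_i^r`, `r ≥ 1`. -/
def powerSum (R : Type*) [CommSemiring R] (r : ℕ) : MvPowerSeries ℕ R :=
  open Classical in fun d => if ∃ i, d = Finsupp.single i r then 1 else 0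

theorem coeff_powerSum_mul {R : Type*} [CommSemiring R] {r : ℕ} (hr : 1 ≤ r)
    (g : MvPowerSeries ℕ R) (d : ℕ →₀ ℕ) :
    MvPowerSeries.coeff d (powerSum R r * g) = ∑ i ∈ d.support,
      if r ≤ d i then MvPowerSeries.coeff (d - Finsupp.single i r) g else 0 := by
  classical
  rw [MvPowerSeries.coeff_mul, ← Finset.sum_filter]
  symm
  refine Finset.sum_of_injOn (fun i => (Finsupp.single i r, d - Finsupp.single i r)) ?_ ?_ ?_ ?_
  · intro i _ j _ hij
    exact Finsupp.single_left_injective (by omega) (Prod.ext_iff.1 hij).1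
  · intro i hi
    simp only [Finset.coe_filter, Set.mem_ofPred_eq] at hi
    simp only [Finset.mem_coe, Finset.HasAntidiagonal.mem_antidiagonal]
    exact add_tsub_cancel_of_le (Finsupp.single_le_iff.2 hi.2)
  · rintro ⟨e, e'⟩ he hnot
    rw [Finset.HasAntidiagonal.mem_antidiagonal] at he
    simp only at he
    change (if ∃ i, e = Finsupp.single i r then (1 : R) else 0) * _ = 0
    rw [if_neg, zero_mul]
    rintro ⟨i, rfl⟩
    refine hnot ⟨i, ?_, ?_⟩
    · have : d i = r + e' i := by rw [← he]; simp
      simp only [Finset.coe_filter, Set.mem_ofPred_eq, Finsupp.mem_support_iff]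
      omega
    · simp [← he]
  · intro i _
    change _ = (if ∃ j, Finsupp.single i r = Finsupp.single j r then (1 : R) else 0) * _
    rw [if_pos ⟨i, rfl⟩, one_mul]

/-- Products of power sums. -/
def powerSumProd (R : Type*) [CommSemiring R] (μ : Multiset ℕ) : MvPowerSeries ℕ R :=
  (μ.map (powerSum R)).prod

/-- Over `ℕ` the coefficients of products of power sums cannot cancel, so nonvanishing is
established there and transported to `K`. -/
theorem map_powerSumProd (μ : Multiset ℕ) :
    MvPowerSeries.map (Nat.castRingHom K) (powerSumProd ℕ μ) = powerSumProd K μ := by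
  classical
  rw [powerSumProd, powerSumProd, map_multiset_prod, Multiset.map_map]
  congr 1
  refine Multiset.map_congr rfl fun r _ => ?_
  ext d
  rw [Function.comp_apply, MvPowerSeries.coeff_map]
  change Nat.castRingHom K (if ∃ i, d = Finsupp.single i r then 1 else 0) =
    if ∃ i, d = Finsupp.single i r then 1 else 0
  split_ifs <;> simp

theorem exponents_add_single {d : ℕ →₀ ℕ} {i a : ℕ} (hi : i ∉ d.support) (ha : 1 ≤ a) :
    exponents (d + Finsupp.single i a) = a ::ₘ exponents d := by
  classical
  have hs : (d + Finsupp.single i a).support = Finset.cons i d.support hi := by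
    ext j
    by_cases hj : j = i
    · subst hj; simp; omega
    · simp [hj]
  rw [exponents, exponents, hs, Finset.cons_val, Multiset.map_cons]
  congr 1
  · simp at hi
    simp [hi]
  · refine Multiset.map_congr rfl fun j hj => ?_
    have : i ≠ j := fun h => hi (h ▸ hj)
    simp [this]

/-- A monomial of the product arises by assigning each part to a variable. Assigning two parts to
the same variable merges them and lowers the number of variables; without merging, the exponents are
exactly the parts. -/
theorem coeff_powerSumProd_ne_zero {μ : Multiset ℕ} (hμ : ∀ a ∈ μ, 1 ≤ a) {d : ℕ →₀ ℕ}
    (h : MvPowerSeries.coeff d (powerSumProd ℕ μ) ≠ 0) :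
    d.support.card ≤ μ.card ∧ (d.support.card = μ.card → exponents d = μ) := by
  classical
  induction μ using Multiset.induction_on generalizing d with
  | empty =>
    rw [powerSumProd, Multiset.map_zero, Multiset.prod_zero, MvPowerSeries.coeff_one] at h
    obtain rfl : d = 0 := by
      by_contra hd
      exact h (if_neg hd)
    simp [exponents]
  | cons a μ ih =>
    have ha := hμ a (Multiset.mem_cons_self a μ)
    rw [powerSumProd, Multiset.map_cons, Multiset.prod_cons, coeff_powerSum_mul ha] at h
    obtain ⟨i, -, hi⟩ := Finset.exists_ne_zero_of_sum_ne_zero h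
    have hle : a ≤ d i := by
      by_contra hlt
      exact hi (if_neg hlt)
    rw [if_pos hle] at hi
    obtain ⟨e, rfl⟩ : ∃ e, d = e + Finsupp.single i a :=
      ⟨d - Finsupp.single i a, (tsub_add_cancel_of_le (Finsupp.single_le_iff.2 hle)).symm⟩
    rw [add_tsub_cancel_right] at hi
    obtain ⟨h1, h2⟩ := ih (fun b hb => hμ b (Multiset.mem_cons_of_mem hb)) hi
    have hs : (e + Finsupp.single i a).support = insert i e.support := by
      ext j
      by_cases hj : j = i
      · subst hj; simp; omega
      · simp [hj]
    have h3 := Finset.card_insert_le i e.support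
    rw [hs, Multiset.card_cons]
    refine ⟨by omega, fun hc => ?_⟩
    have hie : i ∉ e.support := by
      intro hie
      rw [Finset.insert_eq_of_mem hie] at hc
      omega
    rw [exponents_add_single hie ha, h2 (by omega)]

theorem coeff_powerSumProd_pos {μ : Multiset ℕ} (hμ : ∀ a ∈ μ, 1 ≤ a) {d : ℕ →₀ ℕ}
    (h : exponents d = μ) : 0 < MvPowerSeries.coeff d (powerSumProd ℕ μ) := by
  classical
  induction μ using Multiset.induction_on generalizing d with
  | empty =>
    obtain rfl : d = 0 := by
      rw [← Finsupp.degree_eq_zero_iff, ← sum_exponents, h, Multiset.sum_zero]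
    simp [powerSumProd]
  | cons a μ ih =>
    have ha := hμ a (Multiset.mem_cons_self a μ)
    obtain ⟨i, hi, hia⟩ : ∃ i ∈ d.support, d i = a := by
      have : a ∈ exponents d := by rw [h]; exact Multiset.mem_cons_self a μ
      simpa only [exponents, Multiset.mem_map, Finset.mem_val] using this
    obtain ⟨e, rfl⟩ : ∃ e, d = e + Finsupp.single i a :=
      ⟨d - Finsupp.single i a, (tsub_add_cancel_of_le (Finsupp.single_le_iff.2 hia.ge)).symm⟩
    have hie : i ∉ e.support := by
      simp at hia
      simp [hia]
    rw [exponents_add_single hie ha] at h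
    have h1 := ih (fun b hb => hμ b (Multiset.mem_cons_of_mem hb)) (Multiset.cons_inj_right a |>.1 h)
    rw [powerSumProd, Multiset.map_cons, Multiset.prod_cons, coeff_powerSum_mul ha]
    refine Finset.sum_pos' (fun _ _ => Nat.zero_le _) ⟨i, hi, ?_⟩
    rw [if_pos hia.ge, add_tsub_cancel_right]
    exact h1

/-- Triangularity in the number of parts: in a relation, take a partition with the most parts among
those with nonzero coefficient. At a monomial whose exponents are its parts, no other term of the
relation contributes. -/
theorem linearIndependent_powerSumProd (k : ℕ) :
    LinearIndependent K (fun p : k.Partition => powerSumProd K p.parts) := by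
  classical
  rw [Fintype.linearIndependent_iff]
  intro g hg
  by_contra! hne
  obtain ⟨p, hp, hmax⟩ := Finset.exists_max_image
    (Finset.univ.filter fun p : k.Partition => g p ≠ 0) (fun p => p.parts.card)
    (by obtain ⟨p, hp⟩ := hne; exact ⟨p, by simpa using hp⟩)
  simp only [Finset.mem_filter, Finset.mem_univ, true_and] at hp hmax
  have h0 : 0 ∉ p.parts.toList := fun h0 => by
    simpa using p.parts_pos (Multiset.mem_toList.1 h0)
  set d := monomialOfList p.parts.toList
  have hd : exponents d = p.parts := by
    rw [exponents_monomialOfList h0, Multiset.coe_toList]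
  have hcast : ∀ r : k.Partition, MvPowerSeries.coeff d (powerSumProd K r.parts) =
      (MvPowerSeries.coeff d (powerSumProd ℕ r.parts) : ℕ) := fun r => by
    rw [← map_powerSumProd, MvPowerSeries.coeff_map]
    rfl
  have h1 := congrArg (MvPowerSeries.coeff d) hg
  rw [map_sum, map_zero, Finset.sum_eq_single p] at h1
  · rw [MvPowerSeries.coeff_smul, hcast] at h1
    rcases mul_eq_zero.1 h1 with h2 | h2
    · exact hp h2
    · exact (coeff_powerSumProd_pos (fun a ha => p.parts_pos ha) hd).ne' (Nat.cast_eq_zero.1 h2)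
  · intro r _ hrp
    rw [MvPowerSeries.coeff_smul]
    by_cases hr : g r = 0
    · rw [hr, zero_mul]
    · rw [hcast]
      by_contra hcoef
      have h3 : MvPowerSeries.coeff d (powerSumProd ℕ r.parts) ≠ 0 := fun h => by
        rw [h] at hcoef
        simp at hcoef
      obtain ⟨h4, h5⟩ := coeff_powerSumProd_ne_zero (fun a ha => r.parts_pos ha) h3
      have h6 := hmax r hr
      rw [← card_exponents, hd] at h4 h5
      exact hrp (Nat.Partition.ext ((h5 (by omega)).symm))
  · simp

/-- The count behind Newton's identity for one variable of exponent `m`: lowering the exponent by an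
odd `r` has relative weight `2` if the variable survives and `1` if it disappears. -/
theorem two_mul_sum_odd (m : ℕ) : ∑ r ∈ Finset.range m, (if Odd r then 2 else 0) +
    (if Odd m then 1 else 0) = m := by
  induction m with
  | zero => simp
  | succ m ih =>
    rw [Finset.sum_range_succ]
    by_cases h : Odd m
    · rw [if_neg (c := Odd (m + 1)) (by simpa [Nat.odd_add_one] using h)]
      simp only [h, if_true] at ih ⊢
      omega
    · rw [if_pos (c := Odd (m + 1)) (by simpa [Nat.odd_add_one] using h)]
      simp only [h, if_false] at ih ⊢
      omega

/-- This is the logarithmic derivative of `∏ (1 + x_i z)/(1 - x_i z)`, namely `2 ∑ p_r z^(r-1)` over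
odd `r`. It is checked at each monomial: the variable `i` contributes `d i * 2 ^ d.support.card`,
and the exponents add up to `n`. -/
theorem newton_schurQ (n : ℕ) : (n : K) • schurQ n = (2 : K) • ∑ r ∈ Finset.range (n + 1),
    if Odd r then powerSum K r * schurQ (n - r) else 0 := by
  classical
  ext d
  rw [MvPowerSeries.coeff_smul, MvPowerSeries.coeff_smul, map_sum, coeff_schurQ]
  have h1 : ∀ r ∈ Finset.range (n + 1), MvPowerSeries.coeff d
      (if Odd r then powerSum K r * schurQ (n - r) else 0) = ∑ i ∈ d.support,
      if Odd r ∧ r ≤ d i ∧ d.degree = n then (2 : K) ^ (d - Finsupp.single i r).support.card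
        else 0 := by
    intro r hr
    rw [Finset.mem_range] at hr
    by_cases ho : Odd r
    · rw [if_pos ho, coeff_powerSum_mul ho.pos]
      refine Finset.sum_congr rfl fun i _ => ?_
      by_cases hi : r ≤ d i
      · have h3 := congrArg Finsupp.degree
          (tsub_add_cancel_of_le (Finsupp.single_le_iff.2 hi) : d - Finsupp.single i r + _ = d)
        rw [map_add, Finsupp.degree_single] at h3
        have h4 : (d - Finsupp.single i r).degree = n - r ↔ d.degree = n := by omega
        simp only [coeff_schurQ, h4, hi, ho, true_and, if_true]
      · simp [hi]
    · simp [ho]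
  rw [Finset.sum_congr rfl h1, Finset.sum_comm]
  by_cases hd : d.degree = n
  · have h2 : ∀ i ∈ d.support, (2 : K) * ∑ r ∈ Finset.range (n + 1),
        (if Odd r ∧ r ≤ d i ∧ d.degree = n then (2 : K) ^ (d - Finsupp.single i r).support.card
        else 0) = (d i : K) * 2 ^ d.support.card := by
      intro i hi
      have hdi : d i ≤ n := hd ▸ Finsupp.le_degree i d
      obtain ⟨c, hc⟩ : ∃ c, d.support.card = c + 1 :=
        ⟨d.support.card - 1, by have := Finset.card_pos.2 ⟨i, hi⟩; omega⟩
      -- With `c + 1` variables in the monomial, `r < d i` keeps all of them and `r = d i` removes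
      -- `i`; factoring out `2 ^ c` leaves the weights `2` and `1`.
      have hterm : ∀ r, (if Odd r ∧ r ≤ d i ∧ d.degree = n then
          (2 : K) ^ (d - Finsupp.single i r).support.card else 0) =
          2 ^ c * ((if r < d i then (if Odd r then 2 else 0) else 0) +
            if r = d i then (if Odd (d i) then 1 else 0) else 0) := by
        intro r
        rcases lt_trichotomy r (d i) with h | h | h
        · have hs : (d - Finsupp.single i r).support = d.support := by
            ext j
            by_cases hj : j = i
            · subst hj
              simp; omega
            · simp [Ne.symm hj]
          rw [hs, hc, if_pos h, if_neg h.ne, add_zero]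
          by_cases ho : Odd r
          · rw [if_pos ⟨ho, h.le, hd⟩, if_pos ho, pow_succ]
          · simp [ho]
        · have hs : (d - Finsupp.single i r).support = d.support.erase i := by
            ext j
            by_cases hj : j = i
            · subst hj
              simp [h]
            · simp [hj]
          rw [hs, Finset.card_erase_of_mem hi, hc, if_neg h.not_lt, if_pos h, zero_add, h]
          by_cases ho : Odd (d i)
          · rw [if_pos ⟨ho, le_rfl, hd⟩, if_pos ho, add_tsub_cancel_right, mul_one]
          · simp [ho]
        · rw [if_neg (by omega), if_neg h.not_gt, if_neg h.ne']
          simp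
      rw [Finset.sum_congr rfl fun r _ => hterm r, ← Finset.mul_sum, Finset.sum_add_distrib,
        Finset.sum_ite_eq', if_pos (Finset.mem_range.2 (by omega)), ← Finset.sum_filter,
        show (Finset.range (n + 1)).filter (· < d i) = Finset.range (d i) by ext; simp; omega]
      have h5 := congrArg (Nat.cast (R := K)) (two_mul_sum_odd (d i))
      push_cast at h5
      rw [h5, hc, pow_succ]
      ring
    rw [Finset.mul_sum, Finset.sum_congr rfl h2, ← Finset.sum_mul, if_pos hd, ← hd]
    congr 1
    rw [Finsupp.degree_apply, Nat.cast_sum]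
  · simp [hd]

/-! ### Linear independence of the products of odd `q`-functions -/

/-- The span of the products of Schur's `q`-functions indexed by the odd partitions of `n`. -/
def oddSpan (n : ℕ) : Submodule K Series :=
  Submodule.span K {f | ∃ μ : Multiset ℕ, (∀ a ∈ μ, Odd a) ∧ μ.sum = n ∧ schurQProd μ = f}

theorem mul_mem_oddSpan {m n : ℕ} {f g : Series} (hf : f ∈ oddSpan m) (hg : g ∈ oddSpan n) :
    f * g ∈ oddSpan (m + n) := by
  have h : oddSpan m * oddSpan n ≤ oddSpan (m + n) := by
    rw [oddSpan, oddSpan, Submodule.span_mul_span]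
    refine Submodule.span_mono ?_
    rintro _ ⟨_, ⟨μ, hμ, rfl, rfl⟩, _, ⟨ν, hν, rfl, rfl⟩, rfl⟩
    refine ⟨μ + ν, fun a ha => ?_, Multiset.sum_add μ ν, by simp [schurQProd]⟩
    rcases Multiset.mem_add.1 ha with h | h
    · exact hμ a h
    · exact hν a h
  exact h (Submodule.mul_mem_mul hf hg)

theorem schurQ_zero : schurQ 0 = 1 := by
  classical
  ext d
  rw [coeff_schurQ, MvPowerSeries.coeff_one]
  by_cases hd : d = 0
  · simp [hd]
  · rw [if_neg hd, if_neg (by rwa [Finsupp.degree_eq_zero_iff])]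

/-- Newton's identity is solved for its top term: for odd `n` it yields the power sum from `schurQ
n` and smaller data, for even `n > 0` it yields `schurQ n` itself. The divisions by `2` and `n` use
characteristic zero. -/
theorem schurQ_powerSum_mem_oddSpan (n : ℕ) :
    schurQ n ∈ oddSpan n ∧ (Odd n → powerSum K n ∈ oddSpan n) := by
  induction n using Nat.strong_induction_on with
  | _ n ih =>
    have hsum : ∑ r ∈ Finset.range n, (if Odd r then powerSum K r * schurQ (n - r) else 0) ∈
        oddSpan n := by
      refine Submodule.sum_mem _ fun r hr => ?_
      rw [Finset.mem_range] at hr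
      split_ifs with ho
      · have := mul_mem_oddSpan ((ih r hr).2 ho)
          (ih (n - r) (by have := ho.pos; omega)).1
        rwa [Nat.add_sub_cancel' hr.le] at this
      · exact Submodule.zero_mem _
    have hnewton := newton_schurQ n
    rw [Finset.sum_range_succ, Nat.sub_self, schurQ_zero, mul_one] at hnewton
    by_cases ho : Odd n
    · have hq : schurQ n ∈ oddSpan n :=
        Submodule.subset_span ⟨{n}, by simpa using ho, by simp, by simp [schurQProd]⟩
      refine ⟨hq, fun _ => ?_⟩
      rw [if_pos ho, smul_add] at hnewton
      have h2 : powerSum K n = (2 : K)⁻¹ • ((n : K) • schurQ n - (2 : K) •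
          ∑ r ∈ Finset.range n, if Odd r then powerSum K r * schurQ (n - r) else 0) := by
        rw [hnewton, add_sub_cancel_left, smul_smul, inv_mul_cancel₀ two_ne_zero, one_smul]
      rw [h2]
      exact Submodule.smul_mem _ _ (Submodule.sub_mem _ (Submodule.smul_mem _ _ hq)
        (Submodule.smul_mem _ _ hsum))
    · refine ⟨?_, fun h => absurd h ho⟩
      rcases Nat.eq_zero_or_pos n with rfl | hn
      · exact Submodule.subset_span ⟨0, by simp, by simp, by simp [schurQProd, schurQ_zero]⟩
      · rw [if_neg ho, add_zero] at hnewton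
        have hn' : (n : K) ≠ 0 := Nat.cast_ne_zero.2 hn.ne'
        have h2 : schurQ n = (n : K)⁻¹ • ((n : K) • schurQ n) := by
          rw [smul_smul, inv_mul_cancel₀ hn', one_smul]
        rw [h2, hnewton]
        exact Submodule.smul_mem _ _ (Submodule.smul_mem _ _ hsum)

theorem powerSumProd_mem_oddSpan (μ : Multiset ℕ) (hμ : ∀ a ∈ μ, Odd a) :
    powerSumProd K μ ∈ oddSpan μ.sum := by
  induction μ using Multiset.induction_on with
  | empty => exact Submodule.subset_span ⟨0, by simp, by simp, by simp [schurQProd, powerSumProd]⟩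
  | cons a μ ih =>
    rw [powerSumProd, Multiset.map_cons, Multiset.prod_cons, Multiset.sum_cons]
    exact mul_mem_oddSpan ((schurQ_powerSum_mem_oddSpan a).2 (hμ a (Multiset.mem_cons_self a μ)))
      (ih fun b hb => hμ b (Multiset.mem_cons_of_mem hb))

theorem mem_odds_iff {n : ℕ} {p : n.Partition} :
    p ∈ Nat.Partition.odds n ↔ ∀ a ∈ p.parts, Odd a := by
  simp [Nat.Partition.odds, Nat.Partition.restricted]

/-- A dimension count: the span contains the products of odd power sums, which are independent and
indexed by the same set, so its dimension is at least the number of generators. -/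
theorem linearIndependent_schurQProd (k : ℕ) :
    LinearIndependent K (fun p : Nat.Partition.odds k => schurQProd p.1.parts) := by
  rw [linearIndependent_iff_card_le_finrank_span]
  have h1 : LinearIndependent K (fun p : Nat.Partition.odds k => powerSumProd K p.1.parts) :=
    (linearIndependent_powerSumProd k).comp _ Subtype.val_injective
  rw [linearIndependent_iff_card_le_finrank_span] at h1
  refine h1.trans ?_
  have : Module.Finite K (Submodule.span K
      (Set.range fun p : Nat.Partition.odds k => schurQProd p.1.parts)) :=
    Module.Finite.span_of_finite K (Set.finite_range _)
  refine Submodule.finrank_mono (Submodule.span_le.2 ?_)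
  rintro _ ⟨p, rfl⟩
  have h2 := powerSumProd_mem_oddSpan p.1.parts (mem_odds_iff.1 p.2)
  rw [p.1.parts_sum] at h2
  refine Submodule.span_mono ?_ h2
  rintro _ ⟨μ, hμ, hs, rfl⟩
  exact ⟨⟨⟨μ, fun ha => (hμ _ ha).pos, hs⟩, mem_odds_iff.2 hμ⟩, rfl⟩

/-! ### Leading terms under cancellation -/

/-- The monomial `x₁^a x₂^b x₃^{ν₀} x₄^{ν₁} ⋯`. -/
def consPair (a b : ℕ) (ν : ℕ →₀ ℕ) : ℕ →₀ ℕ :=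
  ν.mapDomain (· + 2) + Finsupp.single 1 b + Finsupp.single 0 a

theorem shift_injective : Function.Injective (fun i : ℕ => i + 2) := fun i j h => by
  simpa using h

theorem mapDomain_shift_apply_of_lt (ν : ℕ →₀ ℕ) {i : ℕ} (hi : i < 2) :
    ν.mapDomain (· + 2) i = 0 :=
  Finsupp.mapDomain_of_notMem_range _ _ (by rintro ⟨j, hj⟩; simp at hj; omega)

theorem consPair_zero (a b : ℕ) (ν : ℕ →₀ ℕ) : consPair a b ν 0 = a := by
  simp [consPair, mapDomain_shift_apply_of_lt]

theorem consPair_one (a b : ℕ) (ν : ℕ →₀ ℕ) : consPair a b ν 1 = b := by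
  simp [consPair, mapDomain_shift_apply_of_lt]

theorem exists_eq_consPair (d : ℕ →₀ ℕ) : ∃ ν, d = consPair (d 0) (d 1) ν := by
  refine ⟨d.comapDomain (· + 2) shift_injective.injOn, ?_⟩
  ext i
  match i with
  | 0 => rw [consPair_zero]
  | 1 => rw [consPair_one]
  | i + 2 =>
    have := Finsupp.mapDomain_apply shift_injective
      (d.comapDomain (· + 2) shift_injective.injOn) i
    simp only [Finsupp.comapDomain_apply] at this
    simp [consPair, this]

theorem degree_consPair (a b : ℕ) (ν : ℕ →₀ ℕ) : (consPair a b ν).degree = a + b + ν.degree := by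
  rw [consPair, map_add, map_add, Finsupp.degree_mapDomain, Finsupp.degree_single,
    Finsupp.degree_single]
  ring

/-- The index of the variable to which `x_i` specializes, up to a unit, under cancellation. -/
def cancelIndex : ℕ → Option ℕ
  | 0 => none
  | 1 => none
  | i + 2 => some i

theorem mapDomain_cancelIndex (a b : ℕ) (ν : ℕ →₀ ℕ) :
    (consPair a b ν).mapDomain cancelIndex =
      ν.mapDomain some + Finsupp.single none (a + b) := by
  rw [consPair, Finsupp.mapDomain_add, Finsupp.mapDomain_add, Finsupp.mapDomain_single,
    Finsupp.mapDomain_single, ← Finsupp.mapDomain_comp, add_assoc, add_comm a b,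
    Finsupp.single_add]
  rfl

/-- Each substituted series is a variable times a unit: `t̄ = t · (-(1 + βt)⁻¹)`. Hence the
substitution never lowers degrees. -/
theorem prod_cancelPoint (d : ℕ →₀ ℕ) :
    d.prod (fun s n => cancelPoint s ^ n) =
      MvPowerSeries.monomial (d.mapDomain cancelIndex) 1 *
        (-(1 + MvPowerSeries.C β * MvPowerSeries.X none : MvPowerSeries (Option ℕ) K)⁻¹) ^ d 1 := by
  classical
  induction d using Finsupp.induction_linear with
  | zero => simp
  | add d e hd he =>
    rw [Finsupp.prod_add_index' (fun _ => pow_zero _) (fun _ _ _ => pow_add _ _ _), hd, he,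
      Finsupp.mapDomain_add, Finsupp.add_apply, pow_add, ← one_mul (1 : K),
      ← MvPowerSeries.monomial_mul_monomial, one_mul]
    ring
  | single s n =>
    rw [Finsupp.prod_single_index (h := fun s n => cancelPoint s ^ n) (pow_zero _), Finsupp.mapDomain_single]
    match s with
    | 0 => simp [cancelPoint, cancelIndex, MvPowerSeries.X_pow_eq]
    | 1 =>
      rw [Finsupp.single_eq_same]
      simp only [cancelPoint, cancelIndex]
      rw [← MvPowerSeries.X_pow_eq, ← mul_pow, bar]
      congr 1
      ring
    | i + 2 => simp [cancelPoint, cancelIndex, MvPowerSeries.X_pow_eq]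

/-- In lowest degree the unit counts only through its constant term `-1`, so `t̄` acts as `-t`. -/
theorem coeff_prod_cancelPoint {d : ℕ →₀ ℕ} {e : Option ℕ →₀ ℕ} (h : e.degree ≤ d.degree) :
    MvPowerSeries.coeff e (d.prod (fun s n => cancelPoint s ^ n)) =
      if d.mapDomain cancelIndex = e then (-1) ^ d 1 else 0 := by
  classical
  rw [prod_cancelPoint, MvPowerSeries.coeff_monomial_mul]
  have hdeg : (d.mapDomain cancelIndex).degree = d.degree := Finsupp.degree_mapDomain _ _
  by_cases hle : d.mapDomain cancelIndex ≤ e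
  · have h1 := tsub_add_cancel_of_le hle
    have h2 := congrArg Finsupp.degree h1
    rw [map_add, hdeg] at h2
    have h3 : e - d.mapDomain cancelIndex = 0 := by
      rw [← Finsupp.degree_eq_zero_iff]; omega
    rw [h3, zero_add] at h1
    rw [if_pos hle, if_pos h1, h3]
    simp
  · rw [if_neg hle, if_neg fun h => hle h.le]

/-- The lowest form of `f(t, t̄, x₃, …)` is `f_k(t, -t, x₃, …)`; independence of `t` kills its
coefficient at `t^N x^ν` for `N ≠ 0`. -/
theorem cancellation_relation {k N : ℕ} {f : Series} (hf : f ∈ cancellation)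
    (hk : f ∈ orderGE k) (ν : ℕ →₀ ℕ) (hN : N ≠ 0) (hdeg : N + ν.degree = k) :
    ∑ p ∈ Finset.HasAntidiagonal.antidiagonal N,
      (-1) ^ p.2 * MvPowerSeries.coeff (consPair p.1 p.2 ν) f = 0 := by
  classical
  set e : Option ℕ →₀ ℕ := ν.mapDomain some + Finsupp.single none N with he
  have hen : e none = N := by
    rw [he, Finsupp.add_apply, Finsupp.mapDomain_of_notMem_range _ _ (by simp)]
    simp
  have hedeg : e.degree = k := by
    rw [he, map_add, Finsupp.degree_mapDomain, Finsupp.degree_single, ← hdeg, add_comm]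
  have h0 : MvPowerSeries.coeff e (cancelHom f) = 0 := by
    obtain ⟨g, hg⟩ := hf
    change MvPowerSeries.rename (Function.Embedding.some : ℕ ↪ Option ℕ) g = cancelHom f at hg
    rw [← hg]
    refine MvPowerSeries.coeff_rename_eq_zero _ _ ?_
    rintro ⟨x, hx⟩
    have := DFunLike.congr_fun hx none
    rw [Finsupp.mapDomain_of_notMem_range _ _ (by simp), hen] at this
    exact hN this.symm
  rw [MvPowerSeries.substAlgHom_apply, MvPowerSeries.coeff_subst hasSubst_cancelPoint,
    finsum_eq_sum_of_support_subset (s := (Finset.HasAntidiagonal.antidiagonal N).image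
      fun p => consPair p.1 p.2 ν), Finset.sum_image] at h0
  · rw [← h0]
    refine Finset.sum_congr rfl fun p hp => ?_
    rw [Finset.HasAntidiagonal.mem_antidiagonal] at hp
    rw [coeff_prod_cancelPoint (by rw [hedeg, degree_consPair]; omega), mapDomain_cancelIndex, hp,
      if_pos rfl, consPair_one, smul_eq_mul, mul_comm]
  · intro p _ p' _ h
    have h1 := DFunLike.congr_fun h 0
    have h2 := DFunLike.congr_fun h 1
    simp only [consPair_zero, consPair_one] at h1 h2
    exact Prod.ext h1 h2
  · intro d hd
    rw [Function.mem_support] at hd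
    -- Monomials of `f` below degree `k` are absent, so each contributing monomial is in the range
    -- where `coeff_prod_cancelPoint` applies.
    have hdk : k ≤ d.degree := by
      by_contra hlt
      exact hd (by rw [hk d (by omega), zero_smul])
    rw [coeff_prod_cancelPoint (by omega)] at hd
    have hde : d.mapDomain cancelIndex = e := by
      by_contra hne
      exact hd (by rw [if_neg hne, smul_zero])
    obtain ⟨ν', hν'⟩ := exists_eq_consPair d
    rw [hν', mapDomain_cancelIndex, he] at hde
    have h1 := DFunLike.congr_fun hde none
    rw [Finsupp.add_apply, Finsupp.add_apply, Finsupp.mapDomain_of_notMem_range _ _ (by simp),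
      Finsupp.mapDomain_of_notMem_range _ _ (by simp)] at h1
    simp only [Finsupp.single_eq_same, zero_add] at h1
    rw [h1] at hde
    have h2 : ν' = ν := Finsupp.mapDomain_injective (Option.some_injective ℕ)
      (add_right_cancel hde)
    rw [h2] at hν'
    simp only [Finset.coe_image, Set.mem_image, Finset.mem_coe,
      Finset.HasAntidiagonal.mem_antidiagonal]
    exact ⟨(d 0, d 1), h1, hν'.symm⟩

/-- The sum of the squares of the exponents. -/
def sumSq (d : ℕ →₀ ℕ) : ℕ := ((exponents d).map (· ^ 2)).sum

theorem sumSq_add_single {d : ℕ →₀ ℕ} {i : ℕ} (hi : i ∉ d.support) (a : ℕ) :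
    sumSq (d + Finsupp.single i a) = a ^ 2 + sumSq d := by
  rcases Nat.eq_zero_or_pos a with rfl | ha
  · simp
  · rw [sumSq, exponents_add_single hi ha, Multiset.map_cons, Multiset.sum_cons, sumSq]

theorem notMem_support_shift (ν : ℕ →₀ ℕ) : 1 ∉ (ν.mapDomain (· + 2)).support := by
  rw [Finsupp.notMem_support_iff, mapDomain_shift_apply_of_lt ν (by omega)]

theorem notMem_support_shift_add (ν : ℕ →₀ ℕ) (b : ℕ) :
    0 ∉ (ν.mapDomain (· + 2) + Finsupp.single 1 b).support := by
  rw [Finsupp.notMem_support_iff, Finsupp.add_apply, mapDomain_shift_apply_of_lt ν (by omega)]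
  simp

theorem sumSq_consPair (a b : ℕ) (ν : ℕ →₀ ℕ) : sumSq (consPair a b ν) =
    a ^ 2 + (b ^ 2 + sumSq (ν.mapDomain (· + 2))) := by
  rw [consPair, sumSq_add_single (notMem_support_shift_add ν b),
    sumSq_add_single (notMem_support_shift ν)]

theorem exponents_shift (ν : ℕ →₀ ℕ) : exponents (ν.mapDomain (· + 2)) = exponents ν := by
  have := exponents_embDomain (addRightEmbedding 2) ν
  rwa [Finsupp.embDomain_eq_mapDomain] at this

theorem exponents_consPair {a b : ℕ} (ha : 1 ≤ a) (hb : 1 ≤ b) (ν : ℕ →₀ ℕ) :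
    exponents (consPair a b ν) = a ::ₘ b ::ₘ exponents ν := by
  rw [consPair, exponents_add_single (notMem_support_shift_add ν b) ha,
    exponents_add_single (notMem_support_shift ν) hb, exponents_shift]

/-- This makes the truncated difference `k ^ 2 - sumSq d` a genuine one, usable as a decreasing
measure. -/
theorem sumSq_le (d : ℕ →₀ ℕ) : sumSq d ≤ d.degree ^ 2 := by
  rw [sumSq, ← sum_exponents]
  induction exponents d using Multiset.induction_on with
  | empty => simp
  | cons a s ih =>
    rw [Multiset.map_cons, Multiset.sum_cons, Multiset.sum_cons]
    nlinarith [Nat.zero_le (a * s.sum)]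

theorem zero_notMem_exponents (d : ℕ →₀ ℕ) : 0 ∉ exponents d := by
  simp [exponents]

/-- A symmetric function with the cancellation property is determined, in its lowest degree, by
the coefficients of the monomials with distinct exponents. -/
theorem mem_orderGE_succ_of_strict {k : ℕ} {f : Series} (hs : f ∈ LambdaSharp)
    (hc : f ∈ cancellation) (hk : f ∈ orderGE k)
    (h : ∀ d : ℕ →₀ ℕ, d.degree = k → (exponents d).Nodup → MvPowerSeries.coeff d f = 0) :
    f ∈ orderGE (k + 1) := by
  -- Induction on `k ^ 2 - sumSq d`, so that monomials with a larger sum of squares of exponents are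
  -- settled first.
  have key : ∀ (n : ℕ) (d : ℕ →₀ ℕ), d.degree = k → k ^ 2 - sumSq d = n →
      MvPowerSeries.coeff d f = 0 := by
    intro n
    induction n using Nat.strong_induction_on with
    | _ n ih =>
      intro d hd hn
      by_cases hnd : (exponents d).Nodup
      · exact h d hd hnd
      · rw [Multiset.nodup_iff_ne_cons_cons] at hnd
        push Not at hnd
        obtain ⟨m, μ, hμ⟩ := hnd
        have h0 := zero_notMem_exponents d
        rw [hμ] at h0
        simp only [Multiset.mem_cons, not_or] at h0
        have hm : 1 ≤ m := by omega
        have hμ0 : 0 ∉ μ.toList := by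
          rw [Multiset.mem_toList]
          exact h0.2.2
        set ν := monomialOfList μ.toList with hν
        have hνe : exponents ν = μ := by
          rw [hν, exponents_monomialOfList hμ0, Multiset.coe_toList]
        have hde : exponents d = exponents (consPair m m ν) := by
          rw [exponents_consPair hm hm, hνe, hμ]
        have hdeg : m + m + ν.degree = k := by
          rw [← degree_consPair, ← sum_exponents, ← hde, sum_exponents, hd]
        have hsq : sumSq d = m ^ 2 + (m ^ 2 + sumSq (ν.mapDomain (· + 2))) := by
          rw [← sumSq_consPair, sumSq, hde, sumSq]
        -- A repeated exponent `m` calls for the relation at `t^(2m)`. The other pairs with `a + b =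
        -- 2m` have `a ^ 2 + b ^ 2 > 2 * m ^ 2` and vanish by induction, which leaves the
        -- coefficient at `(m, m)` up to sign.
        have hrel := cancellation_relation hc hk ν (N := m + m) (by omega) hdeg
        rw [Finset.sum_eq_single (m, m)] at hrel
        · rw [coeff_eq_of_exponents_eq hs hde]
          exact (mul_eq_zero.1 hrel).resolve_left (pow_ne_zero _ (by simp))
        · rintro ⟨a, b⟩ hab hne
          rw [Finset.HasAntidiagonal.mem_antidiagonal] at hab
          simp only at hab
          have hne' : a ≠ b := fun hab' => hne (by rw [Prod.mk.injEq]; omega)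
          have hdeg' : (consPair a b ν).degree = k := by rw [degree_consPair]; omega
          have h1 := sumSq_le (consPair a b ν)
          have h2 := sumSq_consPair a b ν
          have h3 : m ^ 2 + m ^ 2 < a ^ 2 + b ^ 2 := by
            rcases lt_or_gt_of_ne hne' with hlt | hlt
            · obtain ⟨r, rfl⟩ : ∃ r, m = a + r := ⟨m - a, by omega⟩
              obtain rfl : b = a + 2 * r := by omega
              nlinarith
            · obtain ⟨r, rfl⟩ : ∃ r, m = b + r := ⟨m - b, by omega⟩
              obtain rfl : a = b + 2 * r := by omega
              nlinarith
          rw [hdeg'] at h1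
          rw [ih _ (by omega) (consPair a b ν) hdeg' rfl, mul_zero]
        · simp
  intro d hd
  rcases Nat.lt_succ_iff_lt_or_eq.1 hd with h1 | h1
  · exact hk d h1
  · exact key _ d h1 rfl

/-! ### The associated graded space -/

/-- The symmetric functions with the cancellation property, without terms of degree less
than `k`. -/
def cancelGE (k : ℕ) : Submodule K Series :=
  Subalgebra.toSubmodule (LambdaSharp ⊓ cancellation) ⊓ orderGE k

theorem GQMonomial_mem_cancelGE (μ : OddPartition) : GQMonomial μ ∈ cancelGE μ.1.sum := by
  refine ⟨Subalgebra.multiset_prod_mem (LambdaSharp ⊓ cancellation) fun f hf => ?_,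
    (GQ_prod_leading μ.1).1⟩
  obtain ⟨n, -, rfl⟩ := Multiset.mem_map.1 hf
  exact ⟨GQ_mem_LambdaSharp n, GQ_mem_cancellation n⟩

/-- The odd partition given by an element of `Nat.Partition.odds`. -/
def oddPartitionOf {k : ℕ} (p : Nat.Partition.odds k) : OddPartition :=
  ⟨p.1.parts, mem_odds_iff.1 p.2⟩

theorem oddPartitionOf_injective (k : ℕ) :
    Function.Injective (oddPartitionOf (k := k)) := fun _ _ h =>
  Subtype.ext (Nat.Partition.ext (Subtype.ext_iff.1 h))

/-- The odd partitions of `k`. -/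
def oddPartitions (k : ℕ) : Finset OddPartition :=
  Finset.univ.map ⟨oddPartitionOf (k := k), oddPartitionOf_injective k⟩

theorem mem_oddPartitions {k : ℕ} {μ : OddPartition} : μ ∈ oddPartitions k ↔ μ.1.sum = k := by
  rw [oddPartitions, Finset.mem_map]
  constructor
  · rintro ⟨p, -, rfl⟩
    exact p.1.parts_sum
  · intro h
    exact ⟨⟨⟨μ.1, fun ha => (μ.2 _ ha).pos, h⟩, mem_odds_iff.2 μ.2⟩, Finset.mem_univ _, rfl⟩

theorem sum_oddPartitions {M : Type*} [AddCommMonoid M] (k : ℕ) (F : OddPartition → M) :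
    ∑ μ ∈ oddPartitions k, F μ = ∑ p : Nat.Partition.odds k, F (oddPartitionOf p) := by
  rw [oddPartitions, Finset.sum_map]
  rfl

theorem sum_GQMonomial_mem (k : ℕ) (a : OddPartition → K) :
    ∑ μ ∈ oddPartitions k, a μ • GQMonomial μ ∈ cancelGE k := by
  refine Submodule.sum_mem _ fun μ hμ => Submodule.smul_mem _ _ ?_
  rw [← mem_oddPartitions.1 hμ]
  exact GQMonomial_mem_cancelGE μ

/-- Modulo degree `k + 1` the sum equals the same combination of products of Schur's functions. That
combination is homogeneous of degree `k`, so it vanishes exactly and linear independence applies. -/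
theorem eq_zero_of_sum_GQMonomial_mem {k : ℕ} {a : OddPartition → K}
    (h : ∑ μ ∈ oddPartitions k, a μ • GQMonomial μ ∈ orderGE (k + 1)) :
    ∀ μ ∈ oddPartitions k, a μ = 0 := by
  have h1 : ∑ μ ∈ oddPartitions k, a μ • GQMonomial μ -
      ∑ μ ∈ oddPartitions k, a μ • schurQProd μ.1 ∈ orderGE (k + 1) := by
    rw [← Finset.sum_sub_distrib]
    refine Submodule.sum_mem _ fun μ hμ => ?_
    rw [← smul_sub, ← mem_oddPartitions.1 hμ]
    exact Submodule.smul_mem _ _ (GQ_prod_leading μ.1).2.2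
  have h2 := Submodule.sub_mem _ h h1
  rw [sub_sub_cancel] at h2
  have h3 : ∑ μ ∈ oddPartitions k, a μ • schurQProd μ.1 = 0 := by
    ext d
    by_cases hd : d.degree = k
    · exact h2 d (by omega)
    · rw [map_sum, map_zero]
      refine Finset.sum_eq_zero fun μ hμ => ?_
      rw [MvPowerSeries.coeff_smul, coeff_schurQProd_of_ne (by rwa [mem_oddPartitions.1 hμ]),
        mul_zero]
  rw [sum_oddPartitions] at h3
  have h4 := Fintype.linearIndependent_iff.1 (linearIndependent_schurQProd k)
    (fun p => a (oddPartitionOf p)) h3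
  intro μ hμ
  obtain ⟨p, -, rfl⟩ := Finset.mem_map.1 hμ
  exact h4 p

/-- The coefficients of the monomials of degree `k` with distinct exponents. -/
def strictCoeffs (k : ℕ) : Series →ₗ[K] (Nat.Partition.distincts k → K) :=
  LinearMap.pi fun p => MvPowerSeries.coeff (monomialOfList p.1.parts.toList)

theorem mem_orderGE_succ_of_strictCoeffs {k : ℕ} {f : Series} (hf : f ∈ cancelGE k)
    (h : strictCoeffs k f = 0) : f ∈ orderGE (k + 1) := by
  refine mem_orderGE_succ_of_strict hf.1.1 hf.1.2 hf.2 fun d hd hnd => ?_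
  let p : k.Partition := ⟨exponents d, fun {i} hi => Nat.pos_of_ne_zero fun h0 =>
    zero_notMem_exponents d (h0 ▸ hi), hd⟩
  have hp : p ∈ Nat.Partition.distincts k := by
    simpa [Nat.Partition.distincts] using hnd
  rw [coeff_eq_of_exponents_eq hf.1.1 (e := monomialOfList p.parts.toList)]
  · exact congrFun h ⟨p, hp⟩
  · rw [exponents_monomialOfList, Multiset.coe_toList]
    rw [Multiset.mem_toList]
    exact zero_notMem_exponents d

/-- Modulo degree `k + 1`, `strictCoeffs k` is injective on `cancelGE k`. The images of the odd
`GQ`-monomials are therefore independent, and they form a basis because the target has the matching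
dimension. -/
theorem exists_leading_expansion {k : ℕ} {f : Series} (hf : f ∈ cancelGE k) :
    ∃ a : OddPartition → K,
      f - ∑ μ ∈ oddPartitions k, a μ • GQMonomial μ ∈ cancelGE (k + 1) := by
  classical
  have hli : LinearIndependent K fun p : Nat.Partition.odds k =>
      strictCoeffs k (GQMonomial (oddPartitionOf p)) := by
    rw [Fintype.linearIndependent_iff]
    intro g hg p
    -- Coefficients on the odd partitions of `k` are extended by zero to all odd partitions.
    obtain ⟨a, ha⟩ : ∃ a : OddPartition → K, ∀ p, a (oddPartitionOf p) = g p :=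
      ⟨Function.extend oddPartitionOf g 0, (oddPartitionOf_injective k).extend_apply g 0⟩
    simp only [← ha, ← map_smul] at hg
    rw [← map_sum, ← sum_oddPartitions k fun μ => a μ • GQMonomial μ] at hg
    rw [← ha]
    exact eq_zero_of_sum_GQMonomial_mem
      (mem_orderGE_succ_of_strictCoeffs (sum_GQMonomial_mem k a) hg) _
      (Finset.mem_map_of_mem _ (Finset.mem_univ p))
  -- Euler's theorem: partitions into odd parts and partitions into distinct parts are equally
  -- numerous.
  have hcard : Fintype.card (Nat.Partition.odds k) =
      Module.finrank K (Nat.Partition.distincts k → K) := by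
    rw [Module.finrank_fintype_fun_eq_card, Fintype.card_coe, Fintype.card_coe,
      Nat.Partition.card_odds_eq_card_distincts]
  have htop := hli.span_eq_top_of_card_eq_finrank' hcard
  have hmem : strictCoeffs k f ∈ Submodule.span K (Set.range fun p : Nat.Partition.odds k =>
      strictCoeffs k (GQMonomial (oddPartitionOf p))) := htop ▸ Submodule.mem_top
  obtain ⟨g, hg⟩ := (Submodule.mem_span_range_iff_exists_fun K).1 hmem
  obtain ⟨a, ha⟩ : ∃ a : OddPartition → K, ∀ p, a (oddPartitionOf p) = g p :=
    ⟨Function.extend oddPartitionOf g 0, (oddPartitionOf_injective k).extend_apply g 0⟩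
  simp only [← ha, ← map_smul] at hg
  rw [← map_sum, ← sum_oddPartitions k fun μ => a μ • GQMonomial μ] at hg
  have hsub := Submodule.sub_mem _ hf (sum_GQMonomial_mem k a)
  exact ⟨a, hsub.1, mem_orderGE_succ_of_strictCoeffs hsub (by rw [map_sub, hg, sub_self])⟩

/-! ### Expansions into infinite sums -/

/-- `GQMonomial μ` has no terms below degree `|μ|`, so only the finitely many odd partitions of size
at most the degree of the monomial matter. -/
theorem coeff_sum_GQMonomial (c : OddPartition → K) (d : ℕ →₀ ℕ) :
    {μ | MvPowerSeries.coeff d (c μ • GQMonomial μ) ≠ 0}.Finite ∧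
      ∑ᶠ μ, MvPowerSeries.coeff d (c μ • GQMonomial μ) =
        MvPowerSeries.coeff d (∑ k ∈ Finset.range (d.degree + 1),
          ∑ μ ∈ oddPartitions k, c μ • GQMonomial μ) := by
  classical
  have hsub : {μ | MvPowerSeries.coeff d (c μ • GQMonomial μ) ≠ 0} ⊆
      ((Finset.range (d.degree + 1)).biUnion oddPartitions : Finset OddPartition) := by
    intro μ hμ
    rw [Finset.mem_coe, Finset.mem_biUnion]
    refine ⟨μ.1.sum, ?_, mem_oddPartitions.2 rfl⟩
    rw [Finset.mem_range]
    by_contra hlt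
    refine hμ ?_
    rw [MvPowerSeries.coeff_smul, (GQMonomial_mem_cancelGE μ).2 d (by omega), mul_zero]
  refine ⟨(Finset.finite_toSet _).subset hsub, ?_⟩
  rw [finsum_eq_sum_of_support_subset _ hsub, Finset.sum_biUnion, map_sum]
  · exact Finset.sum_congr rfl fun k _ => (map_sum _ _ _).symm
  · intro j _ k _ hjk
    rw [Function.onFun, Finset.disjoint_left]
    intro μ h1 h2
    exact hjk ((mem_oddPartitions.1 h1).symm.trans (mem_oddPartitions.1 h2))

/-- Formal summation becomes convergence in the degree filtration, with the partial sums grouped by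
the size of the partition. -/
theorem hasFormalSum_iff {c : OddPartition → K} {f : Series} :
    HasFormalSum (fun μ => c μ • GQMonomial μ) f ↔
      ∀ k, f - ∑ j ∈ Finset.range k, ∑ μ ∈ oddPartitions j, c μ • GQMonomial μ ∈ orderGE k := by
  constructor
  · intro h k d hd
    have h1 := (h d).2
    rw [(coeff_sum_GQMonomial c d).2] at h1
    obtain ⟨m, rfl⟩ : ∃ m, k = d.degree + 1 + m := ⟨k - (d.degree + 1), by omega⟩
    rw [Finset.sum_range_add, ← sub_sub, map_sub, map_sub, ← h1, sub_self, zero_sub, neg_eq_zero,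
      map_sum]
    refine Finset.sum_eq_zero fun j _ => ?_
    exact (sum_GQMonomial_mem _ c).2 d (by omega)
  · intro h d
    refine ⟨(coeff_sum_GQMonomial c d).1, ?_⟩
    rw [(coeff_sum_GQMonomial c d).2]
    have := h (d.degree + 1) d (by omega)
    rw [map_sub, sub_eq_zero] at this
    exact this.symm

theorem exists_hasFormalSum {f : Series} (hf : f ∈ cancelGE 0) :
    ∃ c : OddPartition → K, HasFormalSum (fun μ => c μ • GQMonomial μ) f := by
  choose a ha using fun (k : ℕ) (f : cancelGE k) => exists_leading_expansion f.2
  -- `g k` is the remainder of `f` after its expansion in sizes below `k`; the coefficient of `μ` is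
  -- then chosen at stage `|μ|`.
  let g : ∀ k, cancelGE k := fun k =>
    Nat.rec (motive := fun k => cancelGE k) ⟨f, hf⟩ (fun k f => ⟨_, ha k f⟩) k
  have hg : ∀ k, ((g (k + 1) : cancelGE (k + 1)) : Series) =
      ((g k : cancelGE k) : Series) - ∑ μ ∈ oddPartitions k, a k (g k) μ • GQMonomial μ := fun k => rfl
  refine ⟨fun μ => a μ.1.sum (g μ.1.sum) μ, hasFormalSum_iff.2 fun k => ?_⟩
  have h1 : f - ∑ j ∈ Finset.range k, ∑ μ ∈ oddPartitions j,
      a μ.1.sum (g μ.1.sum) μ • GQMonomial μ = g k := by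
    induction k with
    | zero => simp [g]
    | succ k ih =>
      rw [Finset.sum_range_succ, ← sub_sub, ih, hg]
      congr 1
      refine Finset.sum_congr rfl fun μ hμ => ?_
      obtain rfl := mem_oddPartitions.1 hμ
      rfl
  rw [h1]
  exact (g k).2.2

/-- If the coefficients agree for all sizes below `k`, subtracting the two partial sums through size
`k` leaves a combination of monomials of size `k` that lies in degree at least `k + 1`, hence is
trivial. -/
theorem hasFormalSum_unique {f : Series} {c c' : OddPartition → K}
    (h : HasFormalSum (fun μ => c μ • GQMonomial μ) f)
    (h' : HasFormalSum (fun μ => c' μ • GQMonomial μ) f) : c = c' := by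
  rw [hasFormalSum_iff] at h h'
  have key : ∀ k, ∀ μ ∈ oddPartitions k, c μ = c' μ := by
    intro k
    induction k using Nat.strong_induction_on with
    | _ k ih =>
      have h1 := Submodule.sub_mem _ (h' (k + 1)) (h (k + 1))
      rw [sub_sub_sub_cancel_left, Finset.sum_range_succ, Finset.sum_range_succ,
        Finset.sum_congr rfl fun j hj => Finset.sum_congr rfl fun μ hμ => by
          rw [ih j (Finset.mem_range.1 hj) μ hμ],
        add_sub_add_left_eq_sub, ← Finset.sum_sub_distrib] at h1
      simp only [← sub_smul] at h1
      intro μ hμ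
      exact sub_eq_zero.1
        (eq_zero_of_sum_GQMonomial_mem (a := fun μ => c μ - c' μ) h1 μ hμ)
  funext μ
  exact key _ μ (mem_oddPartitions.2 rfl)

end KQ
end

theorem mainTheorem7 :
    (∀ n : ℕ, 1 ≤ n → ∀ N : ℕ, ∃ P : MvPolynomial (Fin N) (Polynomial ℤ),
      KQ.specialize N (KQ.GQ n) =
        ((MvPolynomial.map KQ.intPolyToK P : MvPolynomial (Fin N) KQ.K) :
          MvPowerSeries (Fin N) KQ.K)) ∧
    (∀ n : ℕ, 1 ≤ n → KQ.GQ n ∈ KQ.GGamma) ∧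
    (∀ f ∈ KQ.GGamma, ∃! c : KQ.OddPartition → KQ.K,
      KQ.HasFormalSum (fun μ => c μ • KQ.GQMonomial μ) f) := by
  refine ⟨fun n hn N => ?_, fun n hn => ?_, fun f hf => ?_⟩
  · obtain ⟨m, rfl⟩ : ∃ m, n = m + 1 := ⟨n - 1, by omega⟩
    exact KQ.specialize_GQ_polynomial m N
  · obtain ⟨m, rfl⟩ : ∃ m, n = m + 1 := ⟨n - 1, by omega⟩
    exact KQ.GQ_mem_GGamma m
  · obtain ⟨c, hc⟩ := KQ.exists_hasFormalSum (f := f)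
      ⟨⟨hf.1.1, hf.2⟩, fun d hd => absurd hd (Nat.not_lt_zero _)⟩
    exact ⟨c, hc, fun c' hc' => KQ.hasFormalSum_unique hc' hc⟩
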